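/- \textbf{Setting.} A \emph{constrained triangulation} $\mathcal T=(T,\mathcal C)$ consists of an oriented simplicial complex $T$ homeomorphic to a disk whose boundary is a quadrilateral with corners $\mathbf p,\mathbf q,\mathbf r,\mathbf s$ (in the cyclic order given by the orientation), and a finite set $\mathcal C$ of constraints; each constraint is the vertex set of a contiguous set of triangles of $T$ (connected in the dual graph), and these sets of triangles are disjoint. A triangle is \emph{living} if no constraint contains all its vertices. A \emph{drawing} is a map $\rho$ from the vertices of $T$ to $\mathbb C^2$ that sends each $C\in\mathcal C$ into a line $\ell_C$ and satisfies $\rho(\mathbf p)+\rho(\mathbf r)=\rho(\mathbf q)+\rho(\mathbf s)$. It is \emph{generic} if it is injective, the parallelogram and all living triangles are non-degenerate, and $\ell_C\ne\ell_{C'}$ for distinct intersecting $C,C'\in\mathcal C$. Let $X(\mathcal T)$ be the closure of the set of generic drawings; $\mathcal T$ is \emph{drawable} if $X(\mathcal T)\neq\emptyset$. Let $A_1,\dots,A_n$ be variables indexed by the living triangles, and $\sigma=A_1+\dots+A_n$. The \emph{area variety} $V\subset\mathbb P^{n-1}$ is the closure of the image of the rational map sending $\rho\in X(\mathcal T)$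 to the vector of signed areas of its living triangles. A drawable $\mathcal T$ is \emph{hyper} if $V$ is a hypersurface; its \emph{area polynomials} are then the two polynomials $\pm p\in\mathbb Z[A_1,\dots,A_n]$ with coprime coefficients that generate the vanishing ideal of $V$. A \emph{drawing order} is a total order on the vertices with $\mathbf p\le\mathbf q\le\mathbf s\le\mathbf r\le v$ for all interior $v$, such that at most two constraints are relevant to each interior $v$, where $C$ is relevant to $v$ if $v\in C$ and $C$ contains at least two vertices before $v$. It gives a rational parameterization of $X(\mathcal T)$ over $\mathbb Q$: $\mathbf p,\mathbf q,\mathbf s$ are free, $\mathbf r=\mathbf q+\mathbf s-\mathbf p$, and an interior $v$ is free, or on the line through the first two vertices of the relevant constraint (one parameter), or the intersection of the two such lines, according as $0$, $1$ or $2$ constraints are relevant to $v$. Let $U$ be the field of rational functions over $\mathbb Q$ in these parameters and $W_j\in U$ the area of the $j$-th living triangle. A \emph{Monsky polynomial} for $\mathcal T$ is a homogeneous polynomial $f\in\mathbb Z[A_1,\dots,A_n]$ such that $2f(W_1,\dots,W_n)=(W_1+\dots+W_n)^e$ in $U$ for some integer $e\ge 0$. \textbf{Proposition.} Let $\mathcal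 T$ be hyper, with area polynomials $\pm p$ of degree $d$, and fix a drawing order. A polynomial $f_0\in\mathbb Q[A_1,\dots,A_n]$ is a Monsky polynomial for $\mathcal T$ if and only if $f_0$ is homogeneous and $f_0=\tfrac12(\sigma^e+pq)$ for some integer $e\ge d$ and some $q\in\mathbb Z[A_1,\dots,A_n]$ with $q\equiv\sigma^{e-d}\pmod 2$. In particular, with $f=\tfrac12(\sigma^d+p)$ and $\tilde f=\tfrac12(\sigma^d-p)$ the canonical Monsky polynomials, the Monsky polynomials of minimal degree are exactly $\{f+mp : m\in\mathbb Z\}=\{\tilde f+mp : m\in\mathbb Z\}$. -/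

import Mathlib

noncomputable section

/-- The (signed) area of the ordered triangle with vertices `P 0, P 1, P 2` in the affine plane
over a field `K`. -/
def triangleArea {K : Type*} [Field K] (P : Fin 3 → Fin 2 → K) : K :=
  (1 / 2) * Matrix.det !![1, 1, 1; P 0 0, P 1 0, P 2 0; P 0 1, P 1 1, P 2 1]

/-- The intersection point (by Cramer's rule) of the line through `a, b` and the line through
`a', b'` in the affine plane over a field. -/
def lineMeet {K : Type*} [Field K] (a b a' b' : Fin 2 → K) : Fin 2 → K :=
  a + (Matrix.det !![(a' - a) 0, (b' - a') 0; (a' - a) 1, (b' - a') 1] /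
      Matrix.det !![(b - a) 0, (b' - a') 0; (b - a) 1, (b' - a') 1]) • (b - a)

/-- Two triangles, given by their vertex maps, share an edge. -/
def ShareEdge {V : Type*} (a b : Fin 3 → V) : Prop :=
  ∃ i j : Fin 3, s(a i, a (i + 1)) = s(b j, b (j + 1))

/-- The dual graph of a family of triangles: two distinct triangles are adjacent if they share
an edge. -/
def trianglesDualGraph {V F : Type*} (vert : F → Fin 3 → V) : SimpleGraph F where
  Adj t u := t ≠ u ∧ ShareEdge (vert t) (vert u)
  symm := ⟨by
    rintro t u ⟨hne, i, j, h⟩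
    exact ⟨hne.symm, j, i, h.symm⟩⟩
  loopless := ⟨fun _ h => h.1 rfl⟩

/-- An oriented simplicial complex homeomorphic to a disk, with vertex set `V` and set of
triangles `F`, whose boundary is a quadrilateral. The triangle `t` has vertices
`vert t 0, vert t 1, vert t 2`, and this cyclic order is its orientation. The corners
`𝐩, 𝐪, 𝐫, 𝐬` are `corner 0, corner 1, corner 2, corner 3`.

The complex is a compact connected oriented surface (edges are in at most two triangles,
traversed in opposite directions, and the links of vertices are connected), its boundary is the
single circle `𝐩 𝐪 𝐫 𝐬`, and its Euler characteristic is `1`; by the classification of surfaces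
this says that it is a disk. -/
structure SquareTriangulation (V F : Type*) [Fintype V] [DecidableEq V] [Fintype F] where
  vert : F → Fin 3 → V
  corner : Fin 4 → V
  vert_injective : ∀ t, Function.Injective (vert t)
  /-- a triangle is determined by its set of vertices -/
  triangle_ext : ∀ t u, Set.range (vert t) = Set.range (vert u) → t = u
  /-- every oriented edge is traversed by at most one triangle -/
  edge_unique : ∀ t u i j, vert t i = vert u j → vert t (i + 1) = vert u (j + 1) → t = u
  corner_injective : Function.Injective corner
  /-- the oriented boundary edges are exactly `𝐩𝐪`, `𝐪𝐫`, `𝐫𝐬`, `𝐬𝐩` -/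
  boundary : ∀ v w : V,
    ((∃ t i, vert t i = v ∧ vert t (i + 1) = w) ∧ ¬ ∃ t i, vert t i = w ∧ vert t (i + 1) = v) ↔
      ∃ k : Fin 4, corner k = v ∧ corner (k + 1) = w
  connected : (trianglesDualGraph vert).Connected
  /-- the triangles around a vertex are connected through edges (which contain that vertex) -/
  link_connected : ∀ v : V,
    ((trianglesDualGraph vert).induce {t | v ∈ Set.range (vert t)}).Connected
  /-- the Euler characteristic is `1` -/
  euler : Fintype.card V + Fintype.card F =
    (Finset.univ.image fun x : F × Fin 3 => s(vert x.1 x.2, vert x.1 (x.2 + 1))).card + 1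

/-- A constrained triangulation: a triangulation of a square with a finite set of collinearity
constraints. Each constraint is the vertex set of a contiguous set of triangles, and these sets of
triangles can be chosen disjoint. -/
structure ConstrainedTriangulation (V F : Type*) [Fintype V] [DecidableEq V] [Fintype F]
    extends SquareTriangulation V F where
  constraints : Finset (Finset V)
  contiguous : ∃ S : Finset V → Set F,
    (∀ C ∈ constraints, ((trianglesDualGraph vert).induce (S C)).Connected ∧
      (C : Set V) = ⋃ t ∈ S C, Set.range (vert t)) ∧
    (∀ C ∈ constraints, ∀ C' ∈ constraints, C ≠ C' → Disjoint (S C) (S C'))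

namespace ConstrainedTriangulation

variable {V F : Type*} [Fintype V] [DecidableEq V] [Fintype F] (T : ConstrainedTriangulation V F)

/-- A triangle is alive if no constraint contains all of its vertices. -/
def Alive (t : F) : Prop := ∀ C ∈ T.constraints, ¬ ∀ i, T.vert t i ∈ C

/-- The type of living triangles. -/
abbrev Living : Type _ := {t : F // T.Alive t}

instance : Fintype T.Living := Fintype.ofFinite _

/-! ### Drawings -/

/-- A drawing: the constraints are drawn on lines and the corners form a parallelogram. -/
structure IsDrawing (ρ : V → Fin 2 → ℂ) : Prop where
  collinear : ∀ C ∈ T.constraints, Collinear ℂ (ρ '' (C : Set V))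
  parallelogram : ρ (T.corner 0) + ρ (T.corner 2) = ρ (T.corner 1) + ρ (T.corner 3)

/-- A generic drawing. As `ρ` is injective and each constraint has at least three vertices,
`affineSpan ℂ (ρ '' C)` is the line on which the constraint `C` is drawn. -/
structure IsGenericDrawing (ρ : V → Fin 2 → ℂ) : Prop extends T.IsDrawing ρ where
  boundary_nondegenerate : ∀ k : Fin 4,
    ¬ Collinear ℂ {ρ (T.corner k), ρ (T.corner (k + 1)), ρ (T.corner (k + 2))}
  living_nondegenerate : ∀ t, T.Alive t →
    ¬ Collinear ℂ {ρ (T.vert t 0), ρ (T.vert t 1), ρ (T.vert t 2)}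
  injective : Function.Injective ρ
  lines_ne : ∀ C ∈ T.constraints, ∀ C' ∈ T.constraints, C ≠ C' → (C ∩ C').Nonempty →
    affineSpan ℂ (ρ '' (C : Set V)) ≠ affineSpan ℂ (ρ '' (C' : Set V))

/-- The space `X(𝒯)`: the closure of the set of generic drawings in `(ℂ²)^V`. -/
def drawingSpace : Set (V → Fin 2 → ℂ) := closure {ρ | T.IsGenericDrawing ρ}

def IsDrawable : Prop := ∃ ρ, T.IsGenericDrawing ρ

/-- The areas of the living triangles when the vertices are placed by `g`. -/
def areas {K : Type*} [Field K] (g : V → Fin 2 → K) (t : T.Living) : K :=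
  triangleArea fun i => g (T.vert t.1 i)

/-! ### The area variety and the area polynomials -/

/-- The image of the rational area map `X(𝒯) ⇢ Y(𝒯)` into the projective space `Y(𝒯)` with one
homogeneous coordinate for each living triangle. -/
def areaImage : Set (Projectivization ℂ (T.Living → ℂ)) :=
  {y | ∃ ρ ∈ T.drawingSpace, ∃ h : T.areas ρ ≠ 0, y = Projectivization.mk ℂ (T.areas ρ) h}

/-- The area variety `V(𝒯)`: the Zariski closure of the image of the area map, i.e. the set of all
points at which every homogeneous polynomial vanishing on the image vanishes. -/
def areaVariety : Set (Projectivization ℂ (T.Living → ℂ)) :=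
  {y | ∀ (m : ℕ) (G : MvPolynomial T.Living ℂ), G.IsHomogeneous m →
    (∀ z ∈ T.areaImage, MvPolynomial.eval z.rep G = 0) → MvPolynomial.eval y.rep G = 0}

/-- `𝒯` is hyper if it is drawable and its area variety is a hypersurface in `Y(𝒯)`, i.e. the zero
locus of one non-zero homogeneous polynomial of positive degree. -/
def IsHyper : Prop :=
  T.IsDrawable ∧ ∃ (m : ℕ) (G : MvPolynomial T.Living ℂ), 0 < m ∧ G ≠ 0 ∧ G.IsHomogeneous m ∧
    T.areaVariety = {y | MvPolynomial.eval y.rep G = 0}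

/-- The (homogeneous) ideal of all polynomials over `ℂ` that vanish on the area variety, that is,
at all homogeneous coordinate vectors of its points. -/
def areaIdeal : Ideal (MvPolynomial T.Living ℂ) :=
  MvPolynomial.vanishingIdeal ℂ
    {x | ∃ h : x ≠ 0, Projectivization.mk ℂ x h ∈ T.areaVariety}

/-- `p` is an area polynomial: it is an integer polynomial whose coefficients have no common
factor, and it is the defining equation of the area variety (it generates its ideal over `ℂ`). -/
def IsAreaPolynomial (p : MvPolynomial T.Living ℤ) : Prop :=
  (∀ a : ℤ, (∀ s, a ∣ p.coeff s) → IsUnit a) ∧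
    T.areaIdeal = Ideal.span {MvPolynomial.map (Int.castRingHom ℂ) p}

/-! ### Drawing orders and the parameter field

A total order on the finite set `V` is given by the order-preserving enumeration
`ord : V ≃ Fin (Fintype.card V)`. -/

/-- The constraints that are relevant to `v`: those that contain `v` and at least two earlier
vertices. -/
def relevant (ord : V ≃ Fin (Fintype.card V)) (v : V) : Finset (Finset V) :=
  T.constraints.filter fun C => v ∈ C ∧ 3 ≤ (C.filter fun w => ord w ≤ ord v).card

/-- The total order is a drawing order: `𝐩 ≤ 𝐪 ≤ 𝐬 ≤ 𝐫 ≤ v` for all interior `v`, and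
`2 - #{constraints relevant to v} ≥ 0` for all interior `v`. -/
structure IsDrawingOrder (ord : V ≃ Fin (Fintype.card V)) : Prop where
  le01 : ord (T.corner 0) ≤ ord (T.corner 1)
  le13 : ord (T.corner 1) ≤ ord (T.corner 3)
  le32 : ord (T.corner 3) ≤ ord (T.corner 2)
  le_interior : ∀ v ∉ Set.range T.corner, ord (T.corner 2) ≤ ord v
  card_relevant_le : ∀ v ∉ Set.range T.corner, (T.relevant ord v).card ≤ 2

open Classical in
/-- The number `α_v` of parameters for the vertex `v`. -/
def alpha (ord : V ≃ Fin (Fintype.card V)) (v : V) : ℕ :=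
  if v = T.corner 2 then 0
  else if v ∈ Set.range T.corner then 2
  else 2 - (T.relevant ord v).card

/-- The parameters: `α_v` of them for each vertex `v`. -/
abbrev Param (ord : V ≃ Fin (Fintype.card V)) : Type _ :=
  {x : V × Fin 2 // (x.2 : ℕ) < T.alpha ord x.1}

/-- The parameter field `U`, the field of rational functions over `ℚ` in the parameters. -/
abbrev ParamField (ord : V ≃ Fin (Fintype.card V)) : Type _ :=
  FractionRing (MvPolynomial (T.Param ord) ℚ)

/-- The `i`-th parameter of the vertex `v` (for `i < α_v`), as an element of `U`. -/
def param (ord : V ≃ Fin (Fintype.card V)) (v : V) (i : Fin 2) : T.ParamField ord :=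
  if h : (i : ℕ) < T.alpha ord v then
    algebraMap (MvPolynomial (T.Param ord) ℚ) (T.ParamField ord) (MvPolynomial.X ⟨(v, i), h⟩)
  else 0

/-- The `k`-th vertex (from `k = 0`) of the constraint `C` in the given order. -/
def nthVertex (ord : V ≃ Fin (Fintype.card V)) (C : Finset V) (k : ℕ) : V :=
  (((List.finRange (Fintype.card V)).map ord.symm).filter (· ∈ C)).getD k (T.corner 0)

open Classical in
/-- The position of the vertex `v` in the generic parameterized drawing, in terms of the positions
`g` of the earlier vertices: `𝐫` completes the parallelogram; otherwise the position is free, or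
on the line through the first two vertices of the relevant constraint, or the intersection of the
two such lines, if there are zero, one or two relevant constraints. -/
def place (ord : V ≃ Fin (Fintype.card V)) (g : V → Fin 2 → T.ParamField ord) (v : V) :
    Fin 2 → T.ParamField ord :=
  if v = T.corner 2 then g (T.corner 1) + g (T.corner 3) - g (T.corner 0)
  else if v ∈ Set.range T.corner then T.param ord v
  else
    match (T.relevant ord v).toList with
    | [] => T.param ord v
    | [C] => T.param ord v 0 • g (T.nthVertex ord C 0) +
        (1 - T.param ord v 0) • g (T.nthVertex ord C 1)
    | C :: C' :: _ => lineMeet (g (T.nthVertex ord C 0)) (g (T.nthVertex ord C 1))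
        (g (T.nthVertex ord C' 0)) (g (T.nthVertex ord C' 1))

/-- The parameterized drawing after the first `j` vertices have been placed (the remaining ones
are provisionally at the origin). -/
def placeFirst (ord : V ≃ Fin (Fintype.card V)) : ℕ → V → Fin 2 → T.ParamField ord
  | 0 => fun _ => 0
  | j + 1 => fun v =>
      if (ord v : ℕ) = j then T.place ord (placeFirst ord j) v else placeFirst ord j v

/-- The parameterization `g_≤` of the space of drawings, as a drawing over the field `U`. -/
def parameterization (ord : V ≃ Fin (Fintype.card V)) : V → Fin 2 → T.ParamField ord :=
  T.placeFirst ord (Fintype.card V)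

/-! ### Monsky polynomials -/

/-- `f` is a Monsky polynomial: it has integer coefficients, is homogeneous, and satisfies
`2 f(W₁, …, Wₙ) = (W₁ + ⋯ + Wₙ) ^ e` in the parameter field for some `e ≥ 0`, where the `Wⱼ` are
the areas of the living triangles in the parameterized drawing. -/
def IsMonskyPolynomial (ord : V ≃ Fin (Fintype.card V)) (f : MvPolynomial T.Living ℚ) : Prop :=
  (∃ g : MvPolynomial T.Living ℤ, MvPolynomial.map (Int.castRingHom ℚ) g = f) ∧
  (∃ m : ℕ, f.IsHomogeneous m) ∧
  ∃ e : ℕ, 2 * MvPolynomial.aeval (T.areas (T.parameterization ord)) f =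
    (∑ t, T.areas (T.parameterization ord) t) ^ e

/-- `f` is a Monsky polynomial of minimal degree. -/
def IsMinimalMonskyPolynomial (ord : V ≃ Fin (Fintype.card V)) (f : MvPolynomial T.Living ℚ) :
    Prop :=
  T.IsMonskyPolynomial ord f ∧ ∀ g, T.IsMonskyPolynomial ord g → f.totalDegree ≤ g.totalDegree

/-- The sum `σ` of the variables. -/
def sigma (R : Type*) [CommRing R] : MvPolynomial T.Living R := ∑ t, MvPolynomial.X t

/-- The polynomial `½ (σ ^ d + p)` with `d = deg p`. -/
def canonicalMonsky (p : MvPolynomial T.Living ℤ) : MvPolynomial T.Living ℚ :=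
  MvPolynomial.C (1 / 2) *
    (T.sigma ℚ ^ p.totalDegree + MvPolynomial.map (Int.castRingHom ℚ) p)

end ConstrainedTriangulation

end

section

open MvPolynomial

/-! Write `W` for the areas of the parameterized drawing. A homogeneous integer polynomial `g` is
Monsky exactly when `2 * g - σ ^ e` vanishes at `W` for some `e`, so two facts decide everything:
which homogeneous integer polynomials vanish at `W`, and what `p` looks like modulo 2.

Relations. Every generic complex drawing is a specialization of the parameterization
(`IsDetGeneric.exists_hasValueAt`), so relations at `W` hold in all generic drawings. Conversely,
the parameter field embeds in `ℂ` and makes the parameterization itself a generic complex drawing.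
Hence the homogeneous relations at `W` are those vanishing on the area variety, and by Gauss's lemma
these are the integer multiples `p * q` (`IsAreaPolynomial.dvd_of_aeval_eq_zero`).

Modulo 2. Monsky's valuation and colouring argument (`IsDetGeneric.exists_two_mul_aeval_eq`) yields
one relation `2 * f - σ ^ e`, which `p` must divide. Over `𝔽₂` the linear form `σ` is prime, so `p ≡
σ ^ d` (`IsAreaPolynomial.map_zmod_two`).

Consequently `2 * g = σ ^ e + p * q`, and the right side is divisible by 2 iff `σ ^ d * q ≡ σ ^ e`,
that is `q ≡ σ ^ (e - d)` modulo 2. In the least degree `e = d` the factor `q` is an odd constant `2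
* m + 1`, which gives `f + m * p`. -/

/-! ### Divisibility of integer polynomials -/

/-- An integer polynomial without common factor of its coefficients divides `h` if it divides a
nonzero integer multiple of `h`. -/
theorem MvPolynomial.dvd_of_primitive_of_dvd_C_mul {σ : Type*} {p : MvPolynomial σ ℤ}
    (hp : ∀ a : ℤ, (∀ s, a ∣ p.coeff s) → IsUnit a) (N : ℤ) (hN : N ≠ 0) :
    ∀ h : MvPolynomial σ ℤ, p ∣ C N * h → p ∣ h := by
  induction N using UniqueFactorizationMonoid.induction_on_prime with
  | h₁ => exact absurd rfl hN
  | h₂ x hx =>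
    intro h hd
    have : IsUnit (C x : MvPolynomial σ ℤ) := hx.map C
    exact (this.dvd_mul_left).1 hd
  | h₃ a l ha hl ih =>
    intro h hd
    obtain ⟨Q, hQ⟩ := hd
    -- A prime of `ℤ` stays prime in the polynomial ring. It cannot divide the primitive `p`, so it
    -- divides the cofactor and cancels.
    have hl' : Prime (C l : MvPolynomial σ ℤ) := (prime_C_iff σ).2 hl
    have h1 : C l ∣ p * Q := ⟨C a * h, by rw [← hQ, C_mul]; ring⟩
    rcases hl'.dvd_or_dvd h1 with h2 | ⟨Q', rfl⟩
    · exact absurd (hp l ((C_dvd_iff_dvd_coeff _ _).1 h2)) hl.not_isUnit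
    · refine ih ha h ⟨Q', mul_left_cancel₀ hl'.ne_zero ?_⟩
      rw [C_mul] at hQ
      linear_combination hQ

theorem MvPolynomial.exists_int_multiple {σ : Type*} (Q : MvPolynomial σ ℚ) :
    ∃ (N : ℤ) (Q' : MvPolynomial σ ℤ), N ≠ 0 ∧ map (Int.castRingHom ℚ) Q' = C (N : ℚ) * Q := by
  obtain ⟨b, hb⟩ := IsLocalization.exist_integer_multiples_of_finset (nonZeroDivisors ℤ)
    (Q.support.image fun s => Q.coeff s)
  have : ∀ s, ∃ z : ℤ, (z : ℚ) = (b : ℤ) * Q.coeff s := by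
    intro s
    by_cases hs : s ∈ Q.support
    · obtain ⟨z, hz⟩ := hb _ (Finset.mem_image_of_mem _ hs)
      exact ⟨z, by simpa [Submonoid.smul_def] using hz⟩
    · exact ⟨0, by simp [notMem_support_iff.1 hs]⟩
  choose z hz using this
  refine ⟨b, ∑ s ∈ Q.support, monomial s (z s), nonZeroDivisors.coe_ne_zero b, ?_⟩
  conv_rhs => rw [Q.as_sum, Finset.mul_sum]
  simp only [C_mul_monomial, map_sum, map_monomial, eq_intCast, hz]

/-- **Gauss's lemma**: an integer polynomial without common factor of its coefficients divides over
`ℤ` whatever it divides over `ℂ`. -/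
theorem MvPolynomial.dvd_of_primitive_of_map_dvd_map {σ : Type*} {p h : MvPolynomial σ ℤ}
    (hp : ∀ a : ℤ, (∀ s, a ∣ p.coeff s) → IsUnit a)
    (hd : map (Int.castRingHom ℂ) p ∣ map (Int.castRingHom ℂ) h) : p ∣ h := by
  classical
  obtain ⟨Q, hQ⟩ := hd
  -- Descent from `ℂ` to `ℚ`: a `ℚ`-linear retraction `π`, applied to the coefficients of the
  -- quotient, commutes with multiplication by the integer coefficients of `p` and fixes those of
  -- `h`.
  obtain ⟨π, hπ⟩ := LinearMap.exists_leftInverse_of_injective (Algebra.linearMap ℚ ℂ)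
    (LinearMap.ker_eq_bot.2 (algebraMap ℚ ℂ).injective)
  have hπ1 : ∀ x : ℚ, π (x : ℂ) = x := fun x => by simpa using LinearMap.congr_fun hπ x
  have hπz : ∀ (n : ℤ) (x : ℂ), π ((n : ℂ) * x) = n * π x := fun n x => by
    rw [← zsmul_eq_mul, map_zsmul, zsmul_eq_mul]
  let Q₁ : MvPolynomial σ ℚ := ∑ s ∈ Q.support, monomial s (π (Q.coeff s))
  have hQ₁ : ∀ s, Q₁.coeff s = π (Q.coeff s) := by
    intro s
    simp only [Q₁, coeff_sum, coeff_monomial, Finset.sum_ite_eq', mem_support_iff]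
    split_ifs with hs
    · rfl
    · rw [not_not.1 hs, map_zero]
  have hmul : map (Int.castRingHom ℚ) h = map (Int.castRingHom ℚ) p * Q₁ := by
    ext s
    have := congrArg (fun P => π (P.coeff s)) hQ
    simp only [coeff_mul, coeff_map, eq_intCast, map_sum, hπz] at this
    simp only [coeff_mul, coeff_map, eq_intCast, hQ₁]
    rw [← this]
    simpa using (hπ1 (MvPolynomial.coeff s h : ℤ)).symm
  obtain ⟨N, Q', hN, hQ'⟩ := exists_int_multiple Q₁
  refine dvd_of_primitive_of_dvd_C_mul hp N hN h ⟨Q', ?_⟩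
  apply map_injective (Int.castRingHom ℚ) Int.cast_injective
  rw [map_mul, map_mul, hQ', hmul, map_C]
  simp only [eq_intCast]
  ring

/-- Over `𝔽₂`, a homogeneous divisor of a power of the sum of the variables is itself such a
power. -/
theorem MvPolynomial.eq_sum_X_pow_of_dvd {σ : Type*} [Fintype σ] [Nonempty σ]
    {P : MvPolynomial σ (ZMod 2)} {d e : ℕ} (hP : P.IsHomogeneous d)
    (hd : P ∣ (∑ t, X t) ^ e) : P = (∑ t, X t) ^ d := by
  classical
  have hhom : (∑ t, X t : MvPolynomial σ (ZMod 2)).IsHomogeneous 1 :=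
    IsHomogeneous.sum _ _ _ fun i _ => isHomogeneous_X _ i
  have hco : ∀ t : σ, coeff (Finsupp.single t 1) (∑ t, X t : MvPolynomial σ (ZMod 2)) = 1 := by
    intro t
    simp [coeff_sum, coeff_X, Finsupp.single_left_inj]
  obtain ⟨t⟩ := ‹Nonempty σ›
  have hne : (∑ t, X t : MvPolynomial σ (ZMod 2)) ≠ 0 := fun h => by
    simpa [h] using hco t
  have hprime : Prime (∑ t, X t : MvPolynomial σ (ZMod 2)) := by
    apply Irreducible.prime
    apply irreducible_of_totalDegree_eq_one (hhom.totalDegree hne)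
    intro x hx
    exact isUnit_of_dvd_one (by simpa [hco] using hx (Finsupp.single t 1))
  obtain ⟨i, -, u, hu⟩ := (dvd_prime_pow hprime e).1 hd
  obtain ⟨r, hr, hur⟩ := isUnit_iff_eq_C_of_isReduced.1 u.isUnit
  -- With 1 as the only unit of `𝔽₂`, the divisor equals a power of the sum, not just up to a
  -- scalar. Homogeneity then fixes the exponent.
  have hr1 : ∀ r : ZMod 2, IsUnit r → r = 1 := by decide
  rw [hur, hr1 r hr, C_1, mul_one] at hu
  have hid := (hhom.pow i).inj_right (hu ▸ hP) (pow_ne_zero _ hne)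
  rw [hu, ← hid, one_mul]

/-! ### Generic drawings in terms of determinants -/

/-- Twice the signed area of the triangle `a, b, c`. -/
def crossDet {K : Type*} [Field K] (a b c : Fin 2 → K) : K :=
  (b 0 - a 0) * (c 1 - a 1) - (c 0 - a 0) * (b 1 - a 1)

theorem triangleArea_eq {K : Type*} [Field K] (P : Fin 3 → Fin 2 → K) :
    triangleArea P = 1 / 2 * crossDet (P 0) (P 1) (P 2) := by
  simp only [triangleArea, crossDet, Matrix.det_fin_three, Matrix.of_apply, Matrix.cons_val',
    Matrix.cons_val]
  ring

theorem exists_eq_add_smul_of_crossDet_eq_zero {K : Type*} [Field K] {a b c : Fin 2 → K}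
    (hab : a ≠ b) (h : crossDet a b c = 0) : ∃ r : K, c = a + r • (b - a) := by
  unfold crossDet at h
  by_cases h0 : b 0 - a 0 = 0
  · have h1 : b 1 - a 1 ≠ 0 := fun h1 => hab (by
      ext i; fin_cases i
      · exact (sub_eq_zero.1 h0).symm
      · exact (sub_eq_zero.1 h1).symm)
    refine ⟨(c 1 - a 1) / (b 1 - a 1), ?_⟩
    have h2 : c 0 - a 0 = 0 := by
      rw [h0, zero_mul, zero_sub, neg_eq_zero] at h
      exact (mul_eq_zero.1 h).resolve_right h1
    ext i; fin_cases i
    · simp [h0]; exact sub_eq_zero.1 h2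
    · simp [h1]
  · refine ⟨(c 0 - a 0) / (b 0 - a 0), ?_⟩
    ext i; fin_cases i
    · simp [h0]
    · simp; field_simp; linear_combination h

theorem collinear_iff_crossDet {K : Type*} [Field K] {s : Set (Fin 2 → K)} :
    Collinear K s ↔ ∀ a ∈ s, ∀ b ∈ s, ∀ c ∈ s, crossDet a b c = 0 := by
  constructor
  · intro h a ha b hb c hc
    obtain ⟨p, v, hv⟩ := (collinear_iff_exists_forall_eq_smul_vadd s).1 h
    obtain ⟨x, rfl⟩ := hv a ha
    obtain ⟨y, rfl⟩ := hv b hb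
    obtain ⟨z, rfl⟩ := hv c hc
    simp [crossDet]
    ring
  · intro h
    by_cases hs : s.Subsingleton
    · rcases hs.eq_empty_or_singleton with rfl | ⟨p, rfl⟩
      · exact collinear_empty K _
      · exact collinear_singleton K p
    · obtain ⟨a, ha, b, hb, hab⟩ := Set.not_subsingleton_iff.1 hs
      refine (collinear_iff_exists_forall_eq_smul_vadd s).2 ⟨a, b - a, fun c hc => ?_⟩
      obtain ⟨r, hr⟩ := exists_eq_add_smul_of_crossDet_eq_zero hab (h a ha b hb c hc)
      exact ⟨r, by rw [hr, vadd_eq_add, add_comm]⟩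

theorem collinear_triple_iff_crossDet {K : Type*} [Field K] {a b c : Fin 2 → K} :
    Collinear K {a, b, c} ↔ crossDet a b c = 0 := by
  rw [collinear_iff_crossDet]
  constructor
  · intro h
    exact h a (by simp) b (by simp) c (by simp)
  · intro h x hx y hy z hz
    simp only [Set.mem_insert_iff, Set.mem_singleton_iff] at hx hy hz
    unfold crossDet at *
    rcases hx with rfl | rfl | rfl <;> rcases hy with rfl | rfl | rfl <;>
      rcases hz with rfl | rfl | rfl <;> first | ring1 | linear_combination h | linear_combination -h

/-- Any two distinct points of a collinear set span its line. This turns the condition `ℓ_C ≠ ℓ_C'`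
into the non-vanishing of some determinant, which makes sense for drawings over any field. -/
theorem affineSpan_eq_iff_collinear_union {K : Type*} [Field K] {s s' : Set (Fin 2 → K)}
    (hs : Collinear K s) (hs' : Collinear K s') (hn : s.Nontrivial) (hn' : s'.Nontrivial) :
    affineSpan K s = affineSpan K s' ↔ Collinear K (s ∪ s') := by
  constructor
  · intro h
    have : Collinear K (affineSpan K s : Set (Fin 2 → K)) := by
      unfold Collinear at *
      rwa [← direction_affineSpan, AffineSubspace.affineSpan_coe, direction_affineSpan]
    refine this.subset (Set.union_subset (subset_affineSpan K s) ?_)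
    rw [h]
    exact subset_affineSpan K s'
  · intro h
    obtain ⟨a, ha, b, hb, hab⟩ := hn
    obtain ⟨a', ha', b', hb', hab'⟩ := hn'
    rw [← hs.affineSpan_eq_of_ne ha hb hab, ← hs'.affineSpan_eq_of_ne ha' hb' hab',
      h.affineSpan_eq_of_ne (Or.inl ha) (Or.inl hb) hab,
      h.affineSpan_eq_of_ne (Or.inr ha') (Or.inr hb') hab']

/-- Points on the line through two distinct points of a set are collinear with any two of them. -/
theorem crossDet_eq_zero_of_line {K : Type*} [Field K] {a b x y z : Fin 2 → K} (hab : a ≠ b)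
    (hx : crossDet a b x = 0) (hy : crossDet a b y = 0) (hz : crossDet a b z = 0) :
    crossDet x y z = 0 := by
  obtain ⟨r, rfl⟩ := exists_eq_add_smul_of_crossDet_eq_zero hab hx
  obtain ⟨s, rfl⟩ := exists_eq_add_smul_of_crossDet_eq_zero hab hy
  obtain ⟨t, rfl⟩ := exists_eq_add_smul_of_crossDet_eq_zero hab hz
  simp [crossDet]
  ring

theorem crossDet_map {K L : Type*} [Field K] [Field L] (φ : K →+* L) (a b c : Fin 2 → K) :
    crossDet (fun i => φ (a i)) (fun i => φ (b i)) (fun i => φ (c i)) = φ (crossDet a b c) := by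
  simp [crossDet]

theorem crossDet_smul {K : Type*} [Field K] (r : K) (a b c : Fin 2 → K) :
    crossDet (r • a) (r • b) (r • c) = r ^ 2 * crossDet a b c := by
  simp [crossDet]
  ring

/-- The determinant of the directions of the lines through `a, b` and `a', b'`. -/
def lineDet {K : Type*} [Field K] (a b a' b' : Fin 2 → K) : K :=
  (b 0 - a 0) * (b' 1 - a' 1) - (b' 0 - a' 0) * (b 1 - a 1)

theorem lineMeet_apply {K : Type*} [Field K] (a b a' b' : Fin 2 → K) (i : Fin 2) :
    lineMeet a b a' b' i = a i + ((a' 0 - a 0) * (b' 1 - a' 1) - (b' 0 - a' 0) * (a' 1 - a 1)) /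
      lineDet a b a' b' * (b i - a i) := by
  simp [lineMeet, lineDet, Matrix.det_fin_two]

theorem crossDet_lineMeet_left {K : Type*} [Field K] (a b a' b' : Fin 2 → K) :
    crossDet a b (lineMeet a b a' b') = 0 := by
  simp only [crossDet, lineMeet_apply]
  ring

theorem crossDet_lineMeet_right {K : Type*} [Field K] {a b a' b' : Fin 2 → K}
    (h : lineDet a b a' b' ≠ 0) : crossDet a' b' (lineMeet a b a' b') = 0 := by
  simp only [crossDet, lineMeet_apply]
  field_simp
  simp only [lineDet]
  ring

/-- Uniqueness of the intersection point: a generic drawing has no choice but to follow the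
parameterization at a vertex with two relevant constraints. -/
theorem eq_lineMeet {K : Type*} [Field K] {a b a' b' c : Fin 2 → K} (hab : a ≠ b)
    (h : lineDet a b a' b' ≠ 0) (hc : crossDet a b c = 0) (hc' : crossDet a' b' c = 0) :
    c = lineMeet a b a' b' := by
  obtain ⟨r, rfl⟩ := exists_eq_add_smul_of_crossDet_eq_zero hab hc
  have hr : r = ((a' 0 - a 0) * (b' 1 - a' 1) - (b' 0 - a' 0) * (a' 1 - a 1)) /
      lineDet a b a' b' := by
    rw [eq_div_iff h]
    simp [crossDet] at hc'
    simp only [lineDet]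
    linear_combination -hc'
  ext i
  rw [lineMeet_apply, ← hr]
  simp

/-- Parallel lines with a common point `c` coincide. -/
theorem crossDet_eq_zero_of_lineDet_eq_zero {K : Type*} [Field K] {a b a' b' c : Fin 2 → K}
    (hab' : a' ≠ b') (h : lineDet a b a' b' = 0) (hc : crossDet a b c = 0)
    (hc' : crossDet a' b' c = 0) : crossDet a b a' = 0 ∧ crossDet a b b' = 0 := by
  obtain ⟨r, hr⟩ := exists_eq_add_smul_of_crossDet_eq_zero hab' hc'
  have h0 : crossDet a b a' = 0 := by
    subst hr
    simp [crossDet] at hc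
    simp only [lineDet] at h
    simp only [crossDet]
    linear_combination hc - r * h
  refine ⟨h0, ?_⟩
  simp only [lineDet] at h
  simp only [crossDet] at *
  linear_combination h0 + h

/-! ### Generic drawings over an arbitrary field -/

namespace ConstrainedTriangulation

variable {V F : Type*} [Fintype V] [DecidableEq V] [Fintype F] (T : ConstrainedTriangulation V F)

/-- The conditions on a generic drawing, over any field and in terms of determinants. -/
structure IsDetGeneric {K : Type*} [Field K] (g : V → Fin 2 → K) : Prop where
  constraint : ∀ C ∈ T.constraints, ∀ x ∈ C, ∀ y ∈ C, ∀ z ∈ C, crossDet (g x) (g y) (g z) = 0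
  parallelogram : g (T.corner 0) + g (T.corner 2) = g (T.corner 1) + g (T.corner 3)
  boundary : ∀ k : Fin 4,
    crossDet (g (T.corner k)) (g (T.corner (k + 1))) (g (T.corner (k + 2))) ≠ 0
  living : ∀ t, T.Alive t → crossDet (g (T.vert t 0)) (g (T.vert t 1)) (g (T.vert t 2)) ≠ 0
  injective : Function.Injective g
  lines : ∀ C ∈ T.constraints, ∀ C' ∈ T.constraints, C ≠ C' → (C ∩ C').Nonempty →
    ∃ x ∈ C ∪ C', ∃ y ∈ C ∪ C', ∃ z ∈ C ∪ C', crossDet (g x) (g y) (g z) ≠ 0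

theorem exists_triangle_subset {C : Finset V} (hC : C ∈ T.constraints) :
    ∃ t, ∀ i, T.vert t i ∈ C := by
  obtain ⟨S, hS, -⟩ := T.contiguous
  obtain ⟨hconn, hCS⟩ := hS C hC
  obtain ⟨t⟩ := hconn.nonempty
  refine ⟨t, fun i => ?_⟩
  rw [← Finset.mem_coe, hCS]
  exact Set.mem_biUnion t.2 ⟨i, rfl⟩

theorem image_constraint_nontrivial {K : Type*} {g : V → Fin 2 → K}
    (hg : Function.Injective g) {C : Finset V} (hC : C ∈ T.constraints) :
    (g '' (C : Set V)).Nontrivial := by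
  obtain ⟨t, ht⟩ := T.exists_triangle_subset hC
  exact ⟨_, ⟨_, ht 0, rfl⟩, _, ⟨_, ht 1, rfl⟩,
    fun h => absurd (T.vert_injective t (hg h)) (by decide)⟩

theorem isGenericDrawing_iff_isDetGeneric (ρ : V → Fin 2 → ℂ) :
    T.IsGenericDrawing ρ ↔ T.IsDetGeneric ρ := by
  have key : ∀ C : Finset V, Collinear ℂ (ρ '' (C : Set V)) ↔
      ∀ x ∈ C, ∀ y ∈ C, ∀ z ∈ C, crossDet (ρ x) (ρ y) (ρ z) = 0 := by
    intro C
    simp [collinear_iff_crossDet]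
  constructor
  · intro h
    refine ⟨fun C hC => (key C).1 (h.collinear C hC), h.parallelogram,
      fun k => collinear_triple_iff_crossDet.not.1 (h.boundary_nondegenerate k),
      fun t ht => collinear_triple_iff_crossDet.not.1 (h.living_nondegenerate t ht),
      h.injective, fun C hC C' hC' hne hi => ?_⟩
    have h1 := h.lines_ne C hC C' hC' hne hi
    rw [Ne, affineSpan_eq_iff_collinear_union (h.collinear C hC) (h.collinear C' hC')
      (T.image_constraint_nontrivial h.injective hC)
      (T.image_constraint_nontrivial h.injective hC'), ← Set.image_union, ← Finset.coe_union,
      key] at h1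
    push Not at h1
    exact h1
  · intro h
    have hc : ∀ C ∈ T.constraints, Collinear ℂ (ρ '' (C : Set V)) :=
      fun C hC => (key C).2 (h.constraint C hC)
    refine ⟨⟨hc, h.parallelogram⟩,
      fun k => collinear_triple_iff_crossDet.not.2 (h.boundary k),
      fun t ht => collinear_triple_iff_crossDet.not.2 (h.living t ht),
      h.injective, fun C hC C' hC' hne hi => ?_⟩
    rw [Ne, affineSpan_eq_iff_collinear_union (hc C hC) (hc C' hC')
      (T.image_constraint_nontrivial h.injective hC)
      (T.image_constraint_nontrivial h.injective hC'), ← Set.image_union, ← Finset.coe_union,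
      key]
    push Not
    exact h.lines C hC C' hC' hne hi

variable {T}

theorem IsDetGeneric.map {K L : Type*} [Field K] [Field L] {g : V → Fin 2 → K}
    (hg : T.IsDetGeneric g) (φ : K →+* L) : T.IsDetGeneric fun v i => φ (g v i) where
  constraint C hC x hx y hy z hz := by
    rw [crossDet_map, hg.constraint C hC x hx y hy z hz, map_zero]
  parallelogram := by
    ext i
    simpa using congrArg φ (congrFun hg.parallelogram i)
  boundary k := by
    rw [crossDet_map]
    exact (map_ne_zero φ).2 (hg.boundary k)
  living t ht := by
    rw [crossDet_map]
    exact (map_ne_zero φ).2 (hg.living t ht)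
  injective v w h := hg.injective (by
    ext i
    exact φ.injective (congrFun h i))
  lines C hC C' hC' hne hi := by
    obtain ⟨x, hx, y, hy, z, hz, h⟩ := hg.lines C hC C' hC' hne hi
    exact ⟨x, hx, y, hy, z, hz, by rw [crossDet_map]; exact (map_ne_zero φ).2 h⟩

/-- Scaling a drawing multiplies its areas by a square; this is what later detects degrees in
relations between areas. -/
theorem IsDetGeneric.smul {K : Type*} [Field K] {g : V → Fin 2 → K}
    (hg : T.IsDetGeneric g) {r : K} (hr : r ≠ 0) : T.IsDetGeneric (r • g) where
  constraint C hC x hx y hy z hz := by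
    simp only [Pi.smul_apply]
    rw [crossDet_smul, hg.constraint C hC x hx y hy z hz, mul_zero]
  parallelogram := by
    simp only [Pi.smul_apply]
    rw [← smul_add, hg.parallelogram, smul_add]
  boundary k := by
    simp only [Pi.smul_apply]
    rw [crossDet_smul]
    exact mul_ne_zero (pow_ne_zero _ hr) (hg.boundary k)
  living t ht := by
    simp only [Pi.smul_apply]
    rw [crossDet_smul]
    exact mul_ne_zero (pow_ne_zero _ hr) (hg.living t ht)
  injective v w h := hg.injective (smul_right_injective _ hr h)
  lines C hC C' hC' hne hi := by
    obtain ⟨x, hx, y, hy, z, hz, h⟩ := hg.lines C hC C' hC' hne hi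
    refine ⟨x, hx, y, hy, z, hz, ?_⟩
    simp only [Pi.smul_apply]
    rw [crossDet_smul]
    exact mul_ne_zero (pow_ne_zero _ hr) h

variable (T)

theorem areas_apply {K : Type*} [Field K] (g : V → Fin 2 → K) (t : T.Living) :
    T.areas g t =
      1 / 2 * crossDet (g (T.vert t.1 0)) (g (T.vert t.1 1)) (g (T.vert t.1 2)) :=
  triangleArea_eq _

theorem areas_map {K L : Type*} [Field K] [Field L] (φ : K →+* L) (g : V → Fin 2 → K) :
    T.areas (fun v i => φ (g v i)) = fun t => φ (T.areas g t) := by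
  ext t
  rw [areas_apply, areas_apply, crossDet_map, map_mul, map_div₀, map_one, map_ofNat]

theorem areas_smul {K : Type*} [Field K] (r : K) (g : V → Fin 2 → K) :
    T.areas (r • g) = r ^ 2 • T.areas g := by
  ext t
  simp only [areas_apply, Pi.smul_apply, crossDet_smul, smul_eq_mul]
  ring

end ConstrainedTriangulation

theorem MvPolynomial.IsHomogeneous.aeval_smul {σ R S : Type*} [Fintype σ] [CommRing R] [CommRing S]
    [Algebra R S] {f : MvPolynomial σ R} {m : ℕ} (hf : f.IsHomogeneous m) (r : S) (x : σ → S) :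
    MvPolynomial.aeval (r • x) f = r ^ m * MvPolynomial.aeval x f := by
  simp only [MvPolynomial.aeval_def, eval₂_eq', Finset.mul_sum]
  refine Finset.sum_congr rfl fun s hs => ?_
  have hs' : ∑ i, s i = m := by
    rw [← Finsupp.degree_eq_sum]
    by_contra h
    exact mem_support_iff.1 hs (hf.coeff_eq_zero h)
  simp only [Pi.smul_apply, smul_eq_mul, mul_pow, Finset.prod_mul_distrib,
    Finset.prod_pow_eq_pow_sum, hs']
  ring

/-! ### Monsky's theorem -/

/-- The sum over the boundaries of all triangles of an antisymmetric function of oriented edges is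
its sum over the boundary of the square. -/
theorem SquareTriangulation.sum_boundary {V F : Type*} [Fintype V] [DecidableEq V] [Fintype F]
    (T : SquareTriangulation V F) {G : Type*} [AddCommGroup G] (φ : V → V → G)
    (hφ : ∀ v w, v ≠ w → φ v w + φ w v = 0) :
    ∑ t, ∑ i, φ (T.vert t i) (T.vert t (i + 1)) =
      ∑ k, φ (T.corner k) (T.corner (k + 1)) := by
  classical
  let e : F × Fin 3 → V × V := fun x => (T.vert x.1 x.2, T.vert x.1 (x.2 + 1))
  have he : Function.Injective e := by
    rintro ⟨t, i⟩ ⟨u, j⟩ h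
    obtain ⟨h1, h2⟩ := Prod.mk.inj h
    obtain rfl := T.edge_unique t u i j h1 h2
    obtain rfl : i = j := T.vert_injective t h1
    rfl
  -- Each oriented edge belongs to one triangle, so the sum runs over `E`. Edges whose reverse is
  -- also in `E` cancel in pairs under `Prod.swap`; the remaining ones are the four sides of the
  -- square.
  let E : Finset (V × V) := Finset.univ.image e
  have hE : ∀ v w, (v, w) ∈ E ↔ ∃ t i, T.vert t i = v ∧ T.vert t (i + 1) = w := by
    intro v w
    simp [E, e]
  have h1 : ∑ t, ∑ i, φ (T.vert t i) (T.vert t (i + 1)) = ∑ x ∈ E, φ x.1 x.2 := by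
    rw [Finset.sum_image fun x _ y _ h => he h, ← Fintype.sum_prod_type']
  have h2 : E.filter (fun x => ¬ x.swap ∈ E) =
      Finset.univ.image fun k => (T.corner k, T.corner (k + 1)) := by
    ext ⟨v, w⟩
    rw [Finset.mem_filter, Prod.swap_prod_mk, hE, hE, T.boundary v w]
    simp
  have h3 : ∑ x ∈ E.filter (fun x => x.swap ∈ E), φ x.1 x.2 = 0 := by
    have hne : ∀ x ∈ E, x.1 ≠ x.2 := by
      rintro ⟨v, w⟩ hx h
      obtain ⟨t, i, hi, hi'⟩ := (hE v w).1 hx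
      have := T.vert_injective t (hi.trans (h.trans hi'.symm))
      revert this
      fin_cases i <;> decide
    refine Finset.sum_involution (fun x _ => x.swap) ?_ ?_ ?_ ?_
    · exact fun x hx => hφ _ _ (hne x (Finset.mem_filter.1 hx).1)
    · exact fun x hx _ h => hne x (Finset.mem_filter.1 hx).1 (congrArg Prod.snd h)
    · intro x hx
      simpa [and_comm] using hx
    · exact fun x _ => Prod.swap_swap x
  rw [h1, ← Finset.sum_filter_add_sum_filter_not E fun x => x.swap ∈ E, h3, zero_add, h2,
    Finset.sum_image fun k _ l _ h => T.corner_injective (Prod.mk.inj h).1]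

/-- The points of the plane over a valued field are coloured by the position of the largest of the
coordinates `1, x, y`. -/
noncomputable def monskyColor {K : Type*} [Field K] (B : ValuationSubring K) (P : Fin 2 → K) : Fin 3 :=
  open Classical in
  if B.valuation (P 0) < 1 ∧ B.valuation (P 1) < 1 then 0
  else if B.valuation (P 1) ≤ B.valuation (P 0) then 1 else 2

section color

variable {K : Type*} [Field K] {B : ValuationSubring K} {P Q R : Fin 2 → K}

theorem monskyColor_eq_zero (h : monskyColor B P = 0) :
    B.valuation (P 0) < 1 ∧ B.valuation (P 1) < 1 := by
  unfold monskyColor at h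
  split_ifs at h with h1 h2
  · exact h1
  · exact absurd h (by decide)
  · exact absurd h (by decide)

theorem monskyColor_eq_one (h : monskyColor B P = 1) :
    1 ≤ B.valuation (P 0) ∧ B.valuation (P 1) ≤ B.valuation (P 0) := by
  unfold monskyColor at h
  split_ifs at h with h1 h2
  · exact absurd h (by decide)
  · refine ⟨?_, h2⟩
    by_contra! h3
    exact h1 ⟨h3, h2.trans_lt h3⟩
  · exact absurd h (by decide)

theorem monskyColor_eq_two (h : monskyColor B P = 2) :
    1 ≤ B.valuation (P 1) ∧ B.valuation (P 0) < B.valuation (P 1) := by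
  unfold monskyColor at h
  split_ifs at h with h1 h2
  · exact absurd h (by decide)
  · exact absurd h (by decide)
  · rw [not_le] at h2
    refine ⟨?_, h2⟩
    by_contra! h3
    exact h1 ⟨h2.trans h3, h3⟩

/-- The determinant of a triangle of three colours has valuation at least `1`. -/
theorem one_le_valuation_crossDet (hP : monskyColor B P = 0) (hQ : monskyColor B Q = 1)
    (hR : monskyColor B R = 2) : 1 ≤ B.valuation (crossDet P Q R) := by
  obtain ⟨p0, p1⟩ := monskyColor_eq_zero hP
  obtain ⟨q0, q1⟩ := monskyColor_eq_one hQ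
  obtain ⟨r1, r0⟩ := monskyColor_eq_two hR
  have e1 : B.valuation (Q 0 - P 0) = B.valuation (Q 0) :=
    Valuation.map_sub_eq_of_lt_left _ (p0.trans_le q0)
  have e2 : B.valuation (R 1 - P 1) = B.valuation (R 1) :=
    Valuation.map_sub_eq_of_lt_left _ (p1.trans_le r1)
  have e3 : B.valuation (Q 1 - P 1) ≤ B.valuation (Q 0) :=
    Valuation.map_sub_le _ q1 (p1.le.trans q0)
  have e4 : B.valuation (R 0 - P 0) < B.valuation (R 1) :=
    Valuation.map_sub_lt _ r0 (p0.trans_le r1)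
  have hq : 0 < B.valuation (Q 0) := zero_lt_one.trans_le q0
  -- The strict inequality in colour 2 makes one product of the determinant dominate the other, so
  -- no cancellation lowers the valuation.
  have hlt : B.valuation ((R 0 - P 0) * (Q 1 - P 1)) <
      B.valuation ((Q 0 - P 0) * (R 1 - P 1)) := by
    rw [map_mul, map_mul, e1, e2, mul_comm (B.valuation (Q 0))]
    exact mul_lt_mul_of_lt_of_le_of_nonneg_of_pos e4 e3 zero_le hq
  rw [crossDet, Valuation.map_sub_eq_of_lt_left _ hlt, map_mul, e1, e2]
  exact one_le_mul q0 r1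

/-- Reordering the vertices changes only the sign. It is needed because the three colours may appear
on a triangle in any order. -/
theorem valuation_crossDet_perm (B : ValuationSubring K) (x : Fin 3 → Fin 2 → K) {i j k : Fin 3}
    (hij : i ≠ j) (hik : i ≠ k) (hjk : j ≠ k) :
    B.valuation (crossDet (x i) (x j) (x k)) = B.valuation (crossDet (x 0) (x 1) (x 2)) := by
  have h : crossDet (x i) (x j) (x k) = crossDet (x 0) (x 1) (x 2) ∨
      crossDet (x i) (x j) (x k) = -crossDet (x 0) (x 1) (x 2) := by
    unfold crossDet
    fin_cases i <;> fin_cases j <;> fin_cases k <;>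
      first
        | exact Or.inl rfl
        | exact absurd rfl hij
        | exact absurd rfl hik
        | exact absurd rfl hjk
        | (simp only [Fin.zero_eta, Fin.isValue, Fin.mk_one, Fin.reduceFinMk]; left; ring1)
        | (simp only [Fin.zero_eta, Fin.isValue, Fin.mk_one, Fin.reduceFinMk]; right; ring1)
  rcases h with h | h
  · rw [h]
  · rw [h, Valuation.map_neg]

end color

namespace ConstrainedTriangulation

variable {V F : Type*} [Fintype V] [DecidableEq V] [Fintype F] {T : ConstrainedTriangulation V F}
  {K : Type*} [Field K] {g : V → Fin 2 → K}

theorem IsDetGeneric.crossDet_eq_zero_of_not_alive (hg : T.IsDetGeneric g) {t : F}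
    (ht : ¬ T.Alive t) : crossDet (g (T.vert t 0)) (g (T.vert t 1)) (g (T.vert t 2)) = 0 := by
  unfold Alive at ht
  push Not at ht
  obtain ⟨C, hC, h⟩ := ht
  exact hg.constraint C hC _ (h 0) _ (h 1) _ (h 2)

/-- The sum of the areas of the living triangles is the area of the parallelogram. -/
theorem IsDetGeneric.sum_areas [CharZero K] (hg : T.IsDetGeneric g) :
    ∑ t, T.areas g t = crossDet (g (T.corner 0)) (g (T.corner 1)) (g (T.corner 3)) := by
  classical
  have h1 : ∑ t, T.areas g t = ∑ t : F, 1 / 2 *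
      crossDet (g (T.vert t 0)) (g (T.vert t 1)) (g (T.vert t 2)) := by
    simp only [areas_apply]
    rw [← Finset.sum_filter_add_sum_filter_not Finset.univ T.Alive, Finset.sum_eq_zero
      (s := Finset.univ.filter fun t => ¬ T.Alive t), add_zero]
    · exact (Finset.sum_subtype _ (fun t => by simp) fun t => 1 / 2 *
        crossDet (g (T.vert t 0)) (g (T.vert t 1)) (g (T.vert t 2))).symm
    · intro t ht
      rw [hg.crossDet_eq_zero_of_not_alive (Finset.mem_filter.1 ht).2, mul_zero]
  -- Shoelace formula: the area of a triangle is the sum of this antisymmetric edge function over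
  -- its sides.
  have h2 := T.sum_boundary (fun v w => 1 / 2 * (g v 0 * g w 1 - g w 0 * g v 1))
    fun v w _ => by ring
  rw [h1]
  have h3 : ∀ t : F, 1 / 2 * crossDet (g (T.vert t 0)) (g (T.vert t 1)) (g (T.vert t 2)) =
      ∑ i, 1 / 2 * (g (T.vert t i) 0 * g (T.vert t (i + 1)) 1 -
        g (T.vert t (i + 1)) 0 * g (T.vert t i) 1) := by
    intro t
    simp only [Fin.sum_univ_three, crossDet, Fin.isValue, zero_add,
      show (1 + 1 : Fin 3) = 2 from rfl, show (2 + 1 : Fin 3) = 0 from rfl]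
    ring
  rw [Finset.sum_congr rfl fun t _ => h3 t, h2]
  have hpar : g (T.corner 2) = g (T.corner 1) + g (T.corner 3) - g (T.corner 0) := by
    rw [← hg.parallelogram]; abel
  simp only [Fin.sum_univ_four, Fin.isValue, zero_add, show (1 + 1 : Fin 4) = 2 from rfl,
      show (2 + 1 : Fin 4) = 3 from rfl, show (3 + 1 : Fin 4) = 0 from rfl, hpar, crossDet,
      Pi.add_apply, Pi.sub_apply]
  field_simp
  ring

theorem IsDetGeneric.crossDet_corner_ne_zero (hg : T.IsDetGeneric g) :
    crossDet (g (T.corner 0)) (g (T.corner 1)) (g (T.corner 3)) ≠ 0 := by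
  have h := hg.boundary 3
  simp only [Fin.isValue, show (3 + 1 : Fin 4) = 0 from rfl,
    show (3 + 2 : Fin 4) = 1 from rfl] at h
  intro h'
  apply h
  rw [← h']
  simp only [crossDet]
  ring

/-- Coordinates in which the parallelogram is the unit square. -/
def squareCoord (T : ConstrainedTriangulation V F) (g : V → Fin 2 → K) (v : V) : Fin 2 → K :=
  ![crossDet (g (T.corner 0)) (g v) (g (T.corner 3)) /
      crossDet (g (T.corner 0)) (g (T.corner 1)) (g (T.corner 3)),
    crossDet (g (T.corner 0)) (g (T.corner 1)) (g v) /
      crossDet (g (T.corner 0)) (g (T.corner 1)) (g (T.corner 3))]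

/-- An affine change of coordinates scales all determinants by one constant. Determinants in square
coordinates are therefore twice the shares of the total area. -/
theorem crossDet_squareCoord
    (h : crossDet (g (T.corner 0)) (g (T.corner 1)) (g (T.corner 3)) ≠ 0) (u v w : V) :
    crossDet (T.squareCoord g u) (T.squareCoord g v) (T.squareCoord g w) =
      crossDet (g u) (g v) (g w) /
        crossDet (g (T.corner 0)) (g (T.corner 1)) (g (T.corner 3)) := by
  unfold squareCoord
  generalize hD : crossDet (g (T.corner 0)) (g (T.corner 1)) (g (T.corner 3)) = D at h ⊢
  rw [crossDet] at hD
  simp only [crossDet, Matrix.cons_val_zero, Matrix.cons_val_one]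
  field_simp
  rw [← hD]
  ring

/-- **Sperner's lemma** for the colouring of the vertices: there is a triangle of three colours. -/
theorem exists_rainbow (T : ConstrainedTriangulation V F) (c : V → Fin 3)
    (h0 : c (T.corner 0) = 0) (h1 : c (T.corner 1) = 1) (h2 : c (T.corner 2) = 1)
    (h3 : c (T.corner 3) = 2) :
    ∃ t, Function.Injective fun i => c (T.vert t i) := by
  by_contra! hno
  -- `f` counts the signed passages between colours 0 and 1. A triangle missing a colour has total
  -- 0, whereas the boundary colours 0, 1, 1, 2 give total 1.
  let f : Fin 3 → Fin 3 → ℤ := fun a b =>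
    if a = 0 ∧ b = 1 then 1 else if a = 1 ∧ b = 0 then -1 else 0
  have hf : ∀ a b, f a b + f b a = 0 := by decide
  have hs := T.sum_boundary (fun v w => f (c v) (c w)) fun v w _ => hf _ _
  have hz : ∀ a : Fin 3 → Fin 3, ¬ Function.Injective a → ∑ i, f (a i) (a (i + 1)) = 0 := by
    decide
  rw [Finset.sum_eq_zero fun t _ => hz _ (hno t)] at hs
  simp only [Fin.sum_univ_four, Fin.isValue, zero_add, show (1 + 1 : Fin 4) = 2 from rfl,
      show (2 + 1 : Fin 4) = 3 from rfl, show (3 + 1 : Fin 4) = 0 from rfl, h0, h1, h2, h3] at hs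
  exact absurd hs (by decide)

/-- In a drawing, the valuation of some living triangle's share of the area is at least
that of `1 / 2`. -/
theorem IsDetGeneric.exists_valuation_area_ge [CharZero K] (hg : T.IsDetGeneric g)
    (B : ValuationSubring K) :
    ∃ t, 1 ≤ B.valuation (2 * (T.areas g t / ∑ t, T.areas g t)) := by
  have hS := hg.crossDet_corner_ne_zero
  have hpar : g (T.corner 2) = g (T.corner 1) + g (T.corner 3) - g (T.corner 0) := by
    rw [← hg.parallelogram]; abel
  have c0 : T.squareCoord g (T.corner 0) = ![0, 0] := by
    simp [squareCoord, crossDet]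
  have c1 : T.squareCoord g (T.corner 1) = ![1, 0] := by
    simp only [squareCoord, div_self hS]
    simp [crossDet, mul_comm]
  have c3 : T.squareCoord g (T.corner 3) = ![0, 1] := by
    simp only [squareCoord, div_self hS]
    simp [crossDet, mul_comm]
  have c2 : T.squareCoord g (T.corner 2) = ![1, 1] := by
    have e1 : crossDet (g (T.corner 0)) (g (T.corner 2)) (g (T.corner 3)) =
        crossDet (g (T.corner 0)) (g (T.corner 1)) (g (T.corner 3)) := by
      simp [hpar, crossDet]; ring
    have e2 : crossDet (g (T.corner 0)) (g (T.corner 1)) (g (T.corner 2)) =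
        crossDet (g (T.corner 0)) (g (T.corner 1)) (g (T.corner 3)) := by
      simp [hpar, crossDet]; ring
    simp only [squareCoord, e1, e2, div_self hS]
  obtain ⟨t, ht⟩ := T.exists_rainbow (fun v => monskyColor B (T.squareCoord g v))
    (by simp [c0, monskyColor]) (by simp [c1, monskyColor]) (by simp [c2, monskyColor])
    (by simp [c3, monskyColor])
  have hle : 1 ≤ B.valuation (crossDet (T.squareCoord g (T.vert t 0))
      (T.squareCoord g (T.vert t 1)) (T.squareCoord g (T.vert t 2))) := by
    obtain ⟨i, hi⟩ := (Finite.injective_iff_surjective.1 ht) 0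
    obtain ⟨j, hj⟩ := (Finite.injective_iff_surjective.1 ht) 1
    obtain ⟨k, hk⟩ := (Finite.injective_iff_surjective.1 ht) 2
    have key := one_le_valuation_crossDet hi hj hk
    have hij : i ≠ j := by rintro rfl; exact absurd (hi.symm.trans hj) (by decide)
    have hik : i ≠ k := by rintro rfl; exact absurd (hi.symm.trans hk) (by decide)
    have hjk : j ≠ k := by rintro rfl; exact absurd (hj.symm.trans hk) (by decide)
    rwa [valuation_crossDet_perm B (fun i => T.squareCoord g (T.vert t i)) hij hik hjk] at key
  -- A dead triangle has determinant 0, hence valuation 0, which is below 1.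
  have hal : T.Alive t := by
    by_contra h
    rw [crossDet_squareCoord hS, hg.crossDet_eq_zero_of_not_alive h, zero_div, map_zero] at hle
    exact absurd hle (by simp)
  refine ⟨⟨t, hal⟩, ?_⟩
  rw [hg.sum_areas, areas_apply]
  rw [crossDet_squareCoord hS] at hle
  convert hle using 2
  field_simp

/-- **Monsky's theorem**: there is a homogeneous integer polynomial `f` such that `2 f` takes the
areas of a drawing to a power of their sum. -/
theorem IsDetGeneric.exists_two_mul_aeval_eq [CharZero K] [Algebra ℤ K] (hg : T.IsDetGeneric g) :
    ∃ (e : ℕ) (f : MvPolynomial T.Living ℤ), f.IsHomogeneous e ∧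
      2 * aeval (T.areas g) f = (∑ t, T.areas g t) ^ e := by
  have hS : ∑ t, T.areas g t ≠ 0 := by
    rw [hg.sum_areas]
    exact hg.crossDet_corner_ne_zero
  let w : T.Living → K := fun t => T.areas g t / ∑ t, T.areas g t
  have hw : ∑ t, w t = 1 := by
    rw [← Finset.sum_div, div_self hS]
  let A : Subring K := (aeval w : MvPolynomial T.Living ℤ →ₐ[ℤ] K).toRingHom.range
  -- `A` is `ℤ[w]`, generated by the area shares. If 2 were not invertible in it, some valuation
  -- ring would contain `A` with 2 in its maximal ideal; then every `2 * w t` would have valuation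
  -- below 1, against `exists_valuation_area_ge`.
  have hunit : Ideal.span {(2 : A)} = ⊤ := by
    by_contra hne
    obtain ⟨B, hAB, hB⟩ := Ideal.image_subset_nonunits_valuationSubring _ hne
    obtain ⟨t, ht⟩ := hg.exists_valuation_area_ge B
    have hwB : B.valuation (w t) ≤ 1 :=
      (B.valuation_le_one_iff _).2 (hAB ⟨X t, by simp⟩)
    have h2 : B.valuation 2 < 1 :=
      (ValuationSubring.mem_nonunits_iff _).1 (hB ⟨2, Ideal.mem_span_singleton_self 2, rfl⟩)
    rw [map_mul] at ht
    exact absurd ht (not_le.2 (mul_lt_one_of_lt_of_le h2 hwB))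
  obtain ⟨⟨_, F, rfl⟩, hF⟩ := Ideal.mem_span_singleton'.1 (hunit.symm ▸ Submodule.mem_top : (1 : A) ∈ _)
  have hF' : aeval w F * 2 = 1 := congrArg Subtype.val hF
  let m := F.totalDegree
  have hsig : (∑ t, X t : MvPolynomial T.Living ℤ).IsHomogeneous 1 :=
    IsHomogeneous.sum _ _ _ fun i _ => isHomogeneous_X _ i
  -- Homogenization of `F` by the sum of the variables, whose value at `w` is 1, so that the value
  -- at `w` is unchanged.
  let G : MvPolynomial T.Living ℤ :=
    ∑ i ∈ Finset.range (m + 1), homogeneousComponent i F * (∑ t, X t) ^ (m - i)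
  have hG : G.IsHomogeneous m := by
    refine IsHomogeneous.sum _ _ _ fun i hi => ?_
    have := (homogeneousComponent_isHomogeneous i F).mul (hsig.pow (m - i))
    rwa [one_mul, Nat.add_sub_cancel' (Nat.lt_succ_iff.1 (Finset.mem_range.1 hi))] at this
  refine ⟨m, G, hG, ?_⟩
  have hGw : aeval w G = aeval w F := by
    simp only [G, map_sum, map_mul, map_pow, aeval_X, hw, one_pow, mul_one]
    rw [← map_sum, sum_homogeneousComponent]
  have hscale : aeval (T.areas g) G = (∑ t, T.areas g t) ^ m * aeval w G := by
    rw [← hG.aeval_smul]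
    congr 2
    ext t
    exact (mul_div_cancel₀ _ hS).symm
  rw [hscale, hGw]
  linear_combination (∑ t, T.areas g t) ^ m * hF'

end ConstrainedTriangulation

/-! ### Specialization of rational functions -/

/-- The pairs of a rational function defined at the point `a` and its value there. -/
def specializationRing {σ : Type*} (a : σ → ℂ) : Subring (FractionRing (MvPolynomial σ ℚ) × ℂ) where
  carrier := {x | ∃ N D : MvPolynomial σ ℚ, aeval a D ≠ 0 ∧
    x.1 * algebraMap _ (FractionRing (MvPolynomial σ ℚ)) D = algebraMap _ _ N ∧
    x.2 * aeval a D = aeval a N}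
  zero_mem' := ⟨0, 1, by simp, by simp, by simp⟩
  one_mem' := ⟨1, 1, by simp, by simp, by simp⟩
  add_mem' := by
    rintro x y ⟨N, D, h0, h1, h2⟩ ⟨N', D', h0', h1', h2'⟩
    refine ⟨N * D' + N' * D, D * D', by simp [h0, h0'], ?_, ?_⟩
    · simp only [map_mul, map_add, Prod.fst_add, ← h1, ← h1']; ring
    · simp only [map_mul, map_add, Prod.snd_add, ← h2, ← h2']; ring
  mul_mem' := by
    rintro x y ⟨N, D, h0, h1, h2⟩ ⟨N', D', h0', h1', h2'⟩
    refine ⟨N * N', D * D', by simp [h0, h0'], ?_, ?_⟩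
    · simp only [map_mul, Prod.fst_mul, ← h1, ← h1']; ring
    · simp only [map_mul, Prod.snd_mul, ← h2, ← h2']; ring
  neg_mem' := by
    rintro x ⟨N, D, h0, h1, h2⟩
    refine ⟨-N, D, h0, ?_, ?_⟩
    · simp only [map_neg, Prod.fst_neg, ← h1]; ring
    · simp only [map_neg, Prod.snd_neg, ← h2]; ring

/-- The rational function `u` is defined at `a` with value `c`. -/
def HasValueAt {σ : Type*} (a : σ → ℂ) (u : FractionRing (MvPolynomial σ ℚ)) (c : ℂ) : Prop :=
  (u, c) ∈ specializationRing a

namespace HasValueAt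

variable {σ : Type*} {a : σ → ℂ} {u u' : FractionRing (MvPolynomial σ ℚ)} {c c' : ℂ}

theorem add (h : HasValueAt a u c) (h' : HasValueAt a u' c') :
    HasValueAt a (u + u') (c + c') := (specializationRing a).add_mem h h'

theorem sub (h : HasValueAt a u c) (h' : HasValueAt a u' c') :
    HasValueAt a (u - u') (c - c') := (specializationRing a).sub_mem h h'

theorem mul (h : HasValueAt a u c) (h' : HasValueAt a u' c') :
    HasValueAt a (u * u') (c * c') := (specializationRing a).mul_mem h h'

theorem one : HasValueAt a 1 1 := (specializationRing a).one_mem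

theorem intCast (n : ℤ) : HasValueAt a (n : FractionRing (MvPolynomial σ ℚ)) (n : ℂ) :=
  intCast_mem (specializationRing a) n

theorem algebraMap (P : MvPolynomial σ ℚ) :
    HasValueAt a (algebraMap _ (FractionRing (MvPolynomial σ ℚ)) P) (aeval a P) :=
  ⟨P, 1, by simp, by simp, by simp⟩

theorem eq_zero (h : HasValueAt a 0 c) : c = 0 := by
  obtain ⟨N, D, h0, h1, h2⟩ := h
  rw [zero_mul, eq_comm, map_eq_zero_iff _ (IsFractionRing.injective _ _)] at h1
  rw [h1, map_zero] at h2
  exact (mul_eq_zero.1 h2).resolve_right h0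

/-- This lifts non-degeneracy from a single complex drawing to the parameterization. -/
theorem ne_zero (h : HasValueAt a u c) (hc : c ≠ 0) : u ≠ 0 := by
  rintro rfl
  exact hc h.eq_zero

theorem unique (h : HasValueAt a u c) (h' : HasValueAt a u c') : c = c' :=
  sub_eq_zero.1 (sub_self u ▸ h.sub h').eq_zero

theorem inv (h : HasValueAt a u c) (hc : c ≠ 0) : HasValueAt a u⁻¹ c⁻¹ := by
  have hu := h.ne_zero hc
  obtain ⟨N, D, h0, h1, h2⟩ := h
  refine ⟨D, N, ?_, ?_, ?_⟩
  · rw [← h2]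
    exact mul_ne_zero hc h0
  · rw [← h1, inv_mul_cancel_left₀ hu]
  · rw [← h2, inv_mul_cancel_left₀ hc]

theorem div (h : HasValueAt a u c) (h' : HasValueAt a u' c') (hc : c' ≠ 0) :
    HasValueAt a (u / u') (c / c') := by
  rw [div_eq_mul_inv, div_eq_mul_inv]
  exact h.mul (h'.inv hc)

theorem aeval {ι : Type*} {x : ι → FractionRing (MvPolynomial σ ℚ)} {y : ι → ℂ}
    (h : ∀ i, HasValueAt a (x i) (y i)) (f : MvPolynomial ι ℤ) :
    HasValueAt a (MvPolynomial.aeval x f) (MvPolynomial.aeval y f) := by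
  induction f using MvPolynomial.induction_on with
  | C n => simpa using intCast n
  | add p q hp hq => simpa using hp.add hq
  | mul_X p i hp => simpa using hp.mul (h i)

theorem crossDet {P Q R : Fin 2 → FractionRing (MvPolynomial σ ℚ)} {P' Q' R' : Fin 2 → ℂ}
    (hP : ∀ i, HasValueAt a (P i) (P' i)) (hQ : ∀ i, HasValueAt a (Q i) (Q' i))
    (hR : ∀ i, HasValueAt a (R i) (R' i)) :
    HasValueAt a (crossDet P Q R) (crossDet P' Q' R') :=
  (((hQ 0).sub (hP 0)).mul ((hR 1).sub (hP 1))).sub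
    (((hR 0).sub (hP 0)).mul ((hQ 1).sub (hP 1)))

theorem lineDet {P Q R S : Fin 2 → FractionRing (MvPolynomial σ ℚ)} {P' Q' R' S' : Fin 2 → ℂ}
    (hP : ∀ i, HasValueAt a (P i) (P' i)) (hQ : ∀ i, HasValueAt a (Q i) (Q' i))
    (hR : ∀ i, HasValueAt a (R i) (R' i)) (hS : ∀ i, HasValueAt a (S i) (S' i)) :
    HasValueAt a (lineDet P Q R S) (lineDet P' Q' R' S') :=
  (((hQ 0).sub (hP 0)).mul ((hS 1).sub (hR 1))).sub
    (((hS 0).sub (hR 0)).mul ((hQ 1).sub (hP 1)))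

theorem lineMeet {P Q R S : Fin 2 → FractionRing (MvPolynomial σ ℚ)} {P' Q' R' S' : Fin 2 → ℂ}
    (hP : ∀ i, HasValueAt a (P i) (P' i)) (hQ : ∀ i, HasValueAt a (Q i) (Q' i))
    (hR : ∀ i, HasValueAt a (R i) (R' i)) (hS : ∀ i, HasValueAt a (S i) (S' i))
    (h : _root_.lineDet P' Q' R' S' ≠ 0) (i : Fin 2) :
    HasValueAt a (lineMeet P Q R S i) (lineMeet P' Q' R' S' i) := by
  rw [lineMeet_apply, lineMeet_apply]
  exact (hP i).add ((((((hR 0).sub (hP 0)).mul ((hS 1).sub (hR 1))).sub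
    (((hS 0).sub (hR 0)).mul ((hR 1).sub (hP 1)))).div (lineDet hP hQ hR hS) h).mul
    ((hQ i).sub (hP i)))

end HasValueAt

/-! ### The parameterization -/

namespace ConstrainedTriangulation

variable {V F : Type*} [Fintype V] [DecidableEq V] [Fintype F] {T : ConstrainedTriangulation V F}
  {ord : V ≃ Fin (Fintype.card V)}

theorem mem_relevant {v : V} {C : Finset V} : C ∈ T.relevant ord v ↔
    C ∈ T.constraints ∧ v ∈ C ∧ 3 ≤ (C.filter fun w => ord w ≤ ord v).card := by
  simp [relevant]

theorem mem_sortedList {C : Finset V} {v : V} :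
    v ∈ (((List.finRange (Fintype.card V)).map ord.symm).filter (· ∈ C)) ↔ v ∈ C := by
  simp only [List.mem_filter, List.mem_map, List.mem_finRange, true_and, decide_eq_true_eq,
    and_iff_right_iff_imp]
  exact fun _ => ⟨ord v, by simp⟩

theorem pairwise_sortedList (ord : V ≃ Fin (Fintype.card V)) (C : Finset V) :
    (((List.finRange (Fintype.card V)).map ord.symm).filter (· ∈ C)).Pairwise
      fun v w => ord v < ord w := by
  apply List.Pairwise.filter
  rw [List.pairwise_map]
  simpa using List.pairwise_lt_finRange _

/-- At least three vertices of `C` come no later than `v`, so `v` is not among the first two. The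
line on which `place` puts `v` is thus already determined. -/
theorem nthVertex_of_mem_relevant {v : V} {C : Finset V} (h : C ∈ T.relevant ord v) :
    T.nthVertex ord C 0 ∈ C ∧ T.nthVertex ord C 1 ∈ C ∧
      ord (T.nthVertex ord C 0) < ord (T.nthVertex ord C 1) ∧
      ord (T.nthVertex ord C 1) < ord v := by
  obtain ⟨-, hv, h3⟩ := mem_relevant.1 h
  have hmem := fun w => @mem_sortedList V _ _ ord C w
  have hpw := pairwise_sortedList ord C
  unfold nthVertex
  generalize (((List.finRange (Fintype.card V)).map ord.symm).filter (· ∈ C)) = L at hmem hpw ⊢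
  have hsub : ∀ {w}, w ∈ C.filter (fun w => ord w ≤ ord v) → w ∈ L ∧ ord w ≤ ord v := by
    intro w hw
    rw [hmem]
    exact Finset.mem_filter.1 hw
  match L with
  | [] => exact absurd ((hmem v).2 hv) (by simp)
  | [x] =>
    have : (C.filter fun w => ord w ≤ ord v) ⊆ {x} := fun w hw => by simpa using (hsub hw).1
    have := Finset.card_le_card this
    simp at this
    omega
  | x :: y :: l =>
    simp only [List.pairwise_cons, List.mem_cons, forall_eq_or_imp] at hpw
    refine ⟨(hmem x).1 (by simp), (hmem y).1 (by simp), hpw.1.1, ?_⟩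
    change ord y < ord v
    by_contra! hlt
    have : (C.filter fun w => ord w ≤ ord v) ⊆ {x, y} := by
      intro w hw
      obtain ⟨h1, h2⟩ := hsub hw
      simp only [List.mem_cons] at h1
      rcases h1 with rfl | rfl | h1
      · simp
      · simp
      · exact absurd (h2.trans hlt) (not_le.2 (hpw.2.1 w h1))
    have := (Finset.card_le_card this).trans Finset.card_le_two
    omega

/-- From the third vertex of `C` on, `C` is relevant. So each vertex of a constraint either helps to
define its line or is constrained to it. -/
theorem eq_nthVertex_or_mem_relevant {v : V} {C : Finset V} (hC : C ∈ T.constraints)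
    (hv : v ∈ C) :
    v = T.nthVertex ord C 0 ∨ v = T.nthVertex ord C 1 ∨ C ∈ T.relevant ord v := by
  have hmem := fun w => @mem_sortedList V _ _ ord C w
  have hpw := pairwise_sortedList ord C
  rw [mem_relevant]
  unfold nthVertex
  generalize (((List.finRange (Fintype.card V)).map ord.symm).filter (· ∈ C)) = L at hmem hpw ⊢
  have hvL := (hmem v).2 hv
  match L with
  | [] => simp at hvL
  | [x] => exact Or.inl (by simpa using hvL)
  | x :: y :: l =>
    simp only [List.pairwise_cons, List.mem_cons, forall_eq_or_imp] at hpw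
    simp only [List.mem_cons] at hvL
    rcases hvL with rfl | rfl | h1
    · exact Or.inl rfl
    · exact Or.inr (Or.inl rfl)
    · have hxy := hpw.1.1
      have hxv := hpw.1.2 v h1
      have hyv := hpw.2.1 v h1
      refine Or.inr (Or.inr ⟨hC, hv, ?_⟩)
      have hcard : ({x, y, v} : Finset V).card = 3 := by
        rw [Finset.card_eq_three]
        exact ⟨x, y, v, fun h => hxy.ne (congrArg ord h), fun h => hxv.ne (congrArg ord h),
          fun h => hyv.ne (congrArg ord h), rfl⟩
      rw [← hcard]
      apply Finset.card_le_card
      intro w hw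
      simp only [Finset.mem_insert, Finset.mem_singleton] at hw
      rw [Finset.mem_filter]
      rcases hw with rfl | rfl | rfl
      · exact ⟨(hmem _).1 (by simp), hxv.le⟩
      · exact ⟨(hmem _).1 (by simp), hyv.le⟩
      · exact ⟨hv, le_rfl⟩

theorem IsDrawingOrder.corner_lt (hord : T.IsDrawingOrder ord) {k : Fin 4} (hk : k ≠ 2) :
    ord (T.corner k) < ord (T.corner 2) := by
  refine lt_of_le_of_ne ?_ fun h => hk (T.corner_injective (ord.injective h))
  have h1 := hord.le01
  have h2 := hord.le13
  have h3 := hord.le32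
  fin_cases k
  · exact h1.trans (h2.trans h3)
  · exact h2.trans h3
  · exact absurd rfl hk
  · exact h3

/-- A constraint contains at most two corners, so none is relevant to a corner. -/
theorem IsDetGeneric.relevant_corner {K : Type*} [Field K] {ρ : V → Fin 2 → K}
    (hρ : T.IsDetGeneric ρ) (hord : T.IsDrawingOrder ord) (k : Fin 4) :
    T.relevant ord (T.corner k) = ∅ := by
  rw [Finset.eq_empty_iff_forall_notMem]
  intro C hC
  obtain ⟨hC, -, h3⟩ := mem_relevant.1 hC
  let I : Finset (Fin 4) := Finset.univ.filter fun j => T.corner j ∈ C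
  have hk2 : ord (T.corner k) ≤ ord (T.corner 2) := by
    by_cases hk : k = 2
    · rw [hk]
    · exact (hord.corner_lt hk).le
  have hsub : (C.filter fun w => ord w ≤ ord (T.corner k)) ⊆ I.image T.corner := by
    intro w hw
    obtain ⟨hwC, hwk⟩ := Finset.mem_filter.1 hw
    by_cases hr : w ∈ Set.range T.corner
    · obtain ⟨j, rfl⟩ := hr
      exact Finset.mem_image_of_mem _ (by simpa [I] using hwC)
    · exact absurd ⟨2, ord.injective ((hord.le_interior w hr).antisymm (hwk.trans hk2))⟩ hr
  have hI : 3 ≤ I.card := h3.trans ((Finset.card_le_card hsub).trans Finset.card_image_le)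
  -- Any three corners are cyclically consecutive, so the non-degeneracy of the parallelogram
  -- applies to them.
  have hdec : ∀ I : Finset (Fin 4), 3 ≤ I.card → ∃ k, k ∈ I ∧ k + 1 ∈ I ∧ k + 2 ∈ I := by decide
  obtain ⟨j, h0, h1, h2⟩ := hdec I hI
  simp only [I, Finset.mem_filter, Finset.mem_univ, true_and] at h0 h1 h2
  exact hρ.boundary j (hρ.constraint C hC _ h0 _ h1 _ h2)

section place

variable (g : V → Fin 2 → T.ParamField ord) {v : V}

theorem place_corner_two :
    T.place ord g (T.corner 2) = g (T.corner 1) + g (T.corner 3) - g (T.corner 0) :=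
  if_pos rfl

theorem place_corner (h2 : v ≠ T.corner 2) (hv : v ∈ Set.range T.corner) :
    T.place ord g v = T.param ord v := by
  rw [place, if_neg h2, if_pos hv]

theorem place_free (hv : v ∉ Set.range T.corner) (h : (T.relevant ord v).toList = []) :
    T.place ord g v = T.param ord v := by
  rw [place, if_neg fun h => hv ⟨2, h.symm⟩, if_neg hv, h]

theorem place_line (hv : v ∉ Set.range T.corner) {C : Finset V}
    (h : (T.relevant ord v).toList = [C]) :
    T.place ord g v = T.param ord v 0 • g (T.nthVertex ord C 0) +
      (1 - T.param ord v 0) • g (T.nthVertex ord C 1) := by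
  rw [place, if_neg fun h => hv ⟨2, h.symm⟩, if_neg hv, h]

theorem place_meet (hv : v ∉ Set.range T.corner) {C C' : Finset V} {l : List (Finset V)}
    (h : (T.relevant ord v).toList = C :: C' :: l) :
    T.place ord g v = lineMeet (g (T.nthVertex ord C 0)) (g (T.nthVertex ord C 1))
        (g (T.nthVertex ord C' 0)) (g (T.nthVertex ord C' 1)) := by
  rw [place, if_neg fun h => hv ⟨2, h.symm⟩, if_neg hv, h]

end place

/-- All vertices consulted by `place` precede `v`, so the provisional zeros in `placeFirst` never
matter. -/
theorem place_congr (hord : T.IsDrawingOrder ord) {g g' : V → Fin 2 → T.ParamField ord} {v : V}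
    (h : ∀ w, ord w < ord v → g w = g' w) : T.place ord g v = T.place ord g' v := by
  by_cases h2 : v = T.corner 2
  · subst h2
    rw [place_corner_two, place_corner_two, h _ (hord.corner_lt (by decide)),
      h _ (hord.corner_lt (by decide)), h _ (hord.corner_lt (by decide))]
  by_cases hv : v ∈ Set.range T.corner
  · rw [place_corner _ h2 hv, place_corner _ h2 hv]
  have hn : ∀ C ∈ T.relevant ord v, g (T.nthVertex ord C 0) = g' (T.nthVertex ord C 0) ∧
      g (T.nthVertex ord C 1) = g' (T.nthVertex ord C 1) := fun C hC => by
    obtain ⟨-, -, h01, h1⟩ := nthVertex_of_mem_relevant hC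
    exact ⟨h _ (h01.trans h1), h _ h1⟩
  rcases hl : (T.relevant ord v).toList with _ | ⟨C, _ | ⟨C', l⟩⟩
  · rw [place_free _ hv hl, place_free _ hv hl]
  · obtain ⟨e0, e1⟩ := hn C (Finset.mem_toList.1 (by simp [hl]))
    rw [place_line _ hv hl, place_line _ hv hl, e0, e1]
  · obtain ⟨e0, e1⟩ := hn C (Finset.mem_toList.1 (by simp [hl]))
    obtain ⟨e0', e1'⟩ := hn C' (Finset.mem_toList.1 (by simp [hl]))
    rw [place_meet _ hv hl, place_meet _ hv hl, e0, e1, e0', e1']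

theorem placeFirst_of_lt {w : V} {j : ℕ} (h : (ord w : ℕ) < j) :
    T.placeFirst ord j w = T.place ord (T.placeFirst ord (ord w)) w := by
  induction j, h using Nat.le_induction with
  | base => simp [placeFirst]
  | succ j hj ih =>
    rw [← ih]
    exact if_neg (by omega)

/-- The parameterization satisfies its defining recursion. -/
theorem parameterization_eq_place (hord : T.IsDrawingOrder ord) (v : V) :
    T.parameterization ord v = T.place ord (T.parameterization ord) v := by
  rw [parameterization, placeFirst_of_lt (ord v).2]
  refine place_congr hord fun w hw => ?_
  rw [placeFirst_of_lt hw, placeFirst_of_lt (ord w).2]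

end ConstrainedTriangulation

/-! ### Generic drawings as specializations of the parameterization -/

namespace ConstrainedTriangulation

variable {V F : Type*} [Fintype V] [DecidableEq V] [Fintype F] {T : ConstrainedTriangulation V F}
  {ord : V ≃ Fin (Fintype.card V)}

theorem IsDetGeneric.nthVertex_ne {K : Type*} [Field K] {ρ : V → Fin 2 → K}
    (hρ : T.IsDetGeneric ρ) {v : V} {C : Finset V} (hC : C ∈ T.relevant ord v) :
    ρ (T.nthVertex ord C 0) ≠ ρ (T.nthVertex ord C 1) := fun h => by
  have := (nthVertex_of_mem_relevant hC).2.2.1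
  rw [hρ.injective h] at this
  exact lt_irrefl _ this

theorem IsDetGeneric.crossDet_nthVertex {K : Type*} [Field K] {ρ : V → Fin 2 → K}
    (hρ : T.IsDetGeneric ρ) {v : V} {C : Finset V} (hC : C ∈ T.relevant ord v) {w : V}
    (hw : w ∈ C) : crossDet (ρ (T.nthVertex ord C 0)) (ρ (T.nthVertex ord C 1)) (ρ w) = 0 := by
  obtain ⟨h0, h1, -⟩ := nthVertex_of_mem_relevant hC
  exact hρ.constraint C (mem_relevant.1 hC).1 _ h0 _ h1 _ hw

/-- The lines of two constraints that are relevant to a vertex are not parallel. -/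
theorem IsDetGeneric.lineDet_ne_zero {K : Type*} [Field K] {ρ : V → Fin 2 → K}
    (hρ : T.IsDetGeneric ρ) {v : V} {C C' : Finset V} (hC : C ∈ T.relevant ord v)
    (hC' : C' ∈ T.relevant ord v) (hne : C ≠ C') :
    lineDet (ρ (T.nthVertex ord C 0)) (ρ (T.nthVertex ord C 1))
      (ρ (T.nthVertex ord C' 0)) (ρ (T.nthVertex ord C' 1)) ≠ 0 := by
  intro h
  obtain ⟨hCT, hvC, -⟩ := mem_relevant.1 hC
  obtain ⟨hCT', hvC', -⟩ := mem_relevant.1 hC'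
  have h01 := hρ.nthVertex_ne hC
  have h01' := hρ.nthVertex_ne hC'
  obtain ⟨e0, e1⟩ := crossDet_eq_zero_of_lineDet_eq_zero h01' h
    (hρ.crossDet_nthVertex hC hvC) (hρ.crossDet_nthVertex hC' hvC')
  obtain ⟨h0, h1, -⟩ := nthVertex_of_mem_relevant hC
  have f0 := crossDet_eq_zero_of_line h01 e0 e1 (hρ.crossDet_nthVertex hC h0)
  have f1 := crossDet_eq_zero_of_line h01 e0 e1 (hρ.crossDet_nthVertex hC h1)
  have hon : ∀ x ∈ C ∪ C',
      crossDet (ρ (T.nthVertex ord C 0)) (ρ (T.nthVertex ord C 1)) (ρ x) = 0 := by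
    intro x hx
    rcases Finset.mem_union.1 hx with hx | hx
    · exact hρ.crossDet_nthVertex hC hx
    · exact crossDet_eq_zero_of_line h01' f0 f1 (hρ.crossDet_nthVertex hC' hx)
  obtain ⟨x, hx, y, hy, z, hz, hxyz⟩ := hρ.lines C hCT C' hCT' hne
    ⟨v, Finset.mem_inter.2 ⟨hvC, hvC'⟩⟩
  exact hxyz (crossDet_eq_zero_of_line h01 (hon x hx) (hon y hy) (hon z hz))

theorem hasValueAt_param {a : T.Param ord → ℂ} {v : V} {i : Fin 2}
    (h : (i : ℕ) < T.alpha ord v) : HasValueAt a (T.param ord v i) (a ⟨(v, i), h⟩) := by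
  rw [param, dif_pos h]
  simpa using HasValueAt.algebraMap (a := a) (X ⟨(v, i), h⟩)

/-- The parameters of a generic drawing. -/
theorem IsDetGeneric.exists_parameters {ρ : V → Fin 2 → ℂ} (hρ : T.IsDetGeneric ρ) :
    ∃ a : T.Param ord → ℂ,
      (∀ v i, v ≠ T.corner 2 → T.relevant ord v = ∅ → HasValueAt a (T.param ord v i) (ρ v i)) ∧
      (∀ v C, v ∉ Set.range T.corner → (T.relevant ord v).toList = [C] → ∃ t : ℂ,
        HasValueAt a (T.param ord v 0) t ∧
        ρ v = t • ρ (T.nthVertex ord C 0) + (1 - t) • ρ (T.nthVertex ord C 1)) := by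
  classical
  have key : ∀ v, ∃ t : ℂ, ∀ C, (T.relevant ord v).toList = [C] →
      ρ v = t • ρ (T.nthVertex ord C 0) + (1 - t) • ρ (T.nthVertex ord C 1) := by
    intro v
    by_cases h : ∃ C, (T.relevant ord v).toList = [C]
    · obtain ⟨C, hC⟩ := h
      have hCr : C ∈ T.relevant ord v := Finset.mem_toList.1 (by simp [hC])
      obtain ⟨r, hr⟩ := exists_eq_add_smul_of_crossDet_eq_zero (hρ.nthVertex_ne hCr)
        (hρ.crossDet_nthVertex hCr (mem_relevant.1 hCr).2.1)
      -- In `place` the parameter is the weight of the first vertex, whereas `r` is the weight of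
      -- the second.
      refine ⟨1 - r, fun C' hC' => ?_⟩
      obtain rfl : C = C' := by simpa [hC] using hC'
      rw [hr]
      module
    · exact ⟨0, fun C hC => absurd ⟨C, hC⟩ h⟩
  choose t ht using key
  refine ⟨fun x => if T.relevant ord x.1.1 = ∅ then ρ x.1.1 x.1.2 else t x.1.1, ?_, ?_⟩
  · intro v i h2 hv
    have hα : (i : ℕ) < T.alpha ord v := by
      have := i.2
      unfold alpha
      rw [if_neg h2]
      split_ifs
      · exact this
      · simpa [hv] using this
    convert hasValueAt_param hα using 1
    simp [hv]
  · intro v C hv hC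
    have hcard : (T.relevant ord v).card = 1 := by
      rw [← Finset.length_toList, hC, List.length_singleton]
    have hα : ((0 : Fin 2) : ℕ) < T.alpha ord v := by
      unfold alpha
      rw [if_neg fun h => hv ⟨2, h.symm⟩, if_neg hv, hcard]
      decide
    refine ⟨t v, ?_, ht v C hC⟩
    convert hasValueAt_param hα using 1
    have : T.relevant ord v ≠ ∅ := fun h => by simp [h] at hcard
    simp [this]

/-- Every generic drawing is a specialization of the parameterization. -/
theorem IsDetGeneric.exists_hasValueAt {ρ : V → Fin 2 → ℂ} (hρ : T.IsDetGeneric ρ)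
    (hord : T.IsDrawingOrder ord) :
    ∃ a : T.Param ord → ℂ, ∀ v i, HasValueAt a (T.parameterization ord v i) (ρ v i) := by
  obtain ⟨a, ha0, ha1⟩ := hρ.exists_parameters
  refine ⟨a, fun v => ?_⟩
  induction hn : (ord v : ℕ) using Nat.strong_induction_on generalizing v with
  | _ n ih =>
    subst hn
    have ih' : ∀ w, ord w < ord v → ∀ i, HasValueAt a (T.parameterization ord w i) (ρ w i) :=
      fun w hw => ih _ hw w rfl
    rw [parameterization_eq_place hord]
    intro i
    by_cases h2 : v = T.corner 2
    · subst h2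
      have : ρ (T.corner 2) = ρ (T.corner 1) + ρ (T.corner 3) - ρ (T.corner 0) := by
        rw [← hρ.parallelogram]; abel
      rw [place_corner_two, this]
      exact ((ih' _ (hord.corner_lt (by decide)) i).add
        (ih' _ (hord.corner_lt (by decide)) i)).sub (ih' _ (hord.corner_lt (by decide)) i)
    by_cases hv : v ∈ Set.range T.corner
    · rw [place_corner _ h2 hv]
      obtain ⟨k, rfl⟩ := hv
      exact ha0 _ i h2 (hρ.relevant_corner hord k)
    have hn : ∀ C ∈ T.relevant ord v,
        (∀ i, HasValueAt a (T.parameterization ord (T.nthVertex ord C 0) i)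
          (ρ (T.nthVertex ord C 0) i)) ∧
        (∀ i, HasValueAt a (T.parameterization ord (T.nthVertex ord C 1) i)
          (ρ (T.nthVertex ord C 1) i)) := fun C hC => by
      obtain ⟨-, -, h01, h1⟩ := nthVertex_of_mem_relevant hC
      exact ⟨ih' _ (h01.trans h1), ih' _ h1⟩
    rcases hl : (T.relevant ord v).toList with _ | ⟨C, _ | ⟨C', l⟩⟩
    · rw [place_free _ hv hl]
      exact ha0 v i h2 (Finset.toList_eq_nil.1 hl)
    · obtain ⟨e0, e1⟩ := hn C (Finset.mem_toList.1 (by simp [hl]))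
      obtain ⟨t, ht, hρv⟩ := ha1 v C hv hl
      rw [place_line _ hv hl, hρv]
      exact (ht.mul (e0 i)).add ((HasValueAt.one.sub ht).mul (e1 i))
    · have hC : C ∈ T.relevant ord v := Finset.mem_toList.1 (by simp [hl])
      have hC' : C' ∈ T.relevant ord v := Finset.mem_toList.1 (by simp [hl])
      have hne : C ≠ C' := by
        have := hl ▸ (T.relevant ord v).nodup_toList
        rintro rfl
        simp at this
      obtain ⟨e0, e1⟩ := hn C hC
      obtain ⟨e0', e1'⟩ := hn C' hC'
      -- The denominator of `lineMeet` does not vanish at the drawing, so the rational function is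
      -- defined there.
      have hdet := hρ.lineDet_ne_zero hC hC' hne
      rw [place_meet _ hv hl, eq_lineMeet (hρ.nthVertex_ne hC) hdet
        (hρ.crossDet_nthVertex hC (mem_relevant.1 hC).2.1)
        (hρ.crossDet_nthVertex hC' (mem_relevant.1 hC').2.1)]
      exact HasValueAt.lineMeet e0 e1 e0' e1' hdet i

/-- If there is a generic drawing, then the parameterization is a generic drawing over the
parameter field. -/
theorem IsDetGeneric.parameterization {ρ : V → Fin 2 → ℂ} (hρ : T.IsDetGeneric ρ)
    (hord : T.IsDrawingOrder ord) : T.IsDetGeneric (T.parameterization ord) := by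
  obtain ⟨a, ha⟩ := hρ.exists_hasValueAt hord
  have hcross : ∀ {x y z}, crossDet (ρ x) (ρ y) (ρ z) ≠ 0 → crossDet (T.parameterization ord x)
      (T.parameterization ord y) (T.parameterization ord z) ≠ 0 := fun h =>
    (HasValueAt.crossDet (ha _) (ha _) (ha _)).ne_zero h
  have hinj : Function.Injective (T.parameterization ord) := fun v w h => hρ.injective (by
    ext i
    exact (ha v i).unique (h ▸ ha w i))
  have hline : ∀ v, ∀ C ∈ T.relevant ord v,
      crossDet (T.parameterization ord (T.nthVertex ord C 0))
        (T.parameterization ord (T.nthVertex ord C 1)) (T.parameterization ord v) = 0 := by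
    intro v C hC
    rw [parameterization_eq_place hord v]
    by_cases hv : v ∈ Set.range T.corner
    · obtain ⟨k, rfl⟩ := hv
      simp [hρ.relevant_corner hord k] at hC
    -- `place` looks only at the first two relevant constraints; the bound of two ensures that it
    -- respects all of them.
    have hcard := hord.card_relevant_le v hv
    rw [← Finset.length_toList] at hcard
    rw [← Finset.mem_toList] at hC
    rcases hl : (T.relevant ord v).toList with _ | ⟨C₁, _ | ⟨C₂, _ | ⟨C₃, l⟩⟩⟩
    · simp [hl] at hC
    · obtain rfl : C = C₁ := by simpa [hl] using hC
      rw [place_line _ hv hl]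
      simp [crossDet]
      ring
    · have hC₁ : C₁ ∈ T.relevant ord v := Finset.mem_toList.1 (by simp [hl])
      have hC₂ : C₂ ∈ T.relevant ord v := Finset.mem_toList.1 (by simp [hl])
      have hne : C₁ ≠ C₂ := by
        have := hl ▸ (T.relevant ord v).nodup_toList
        rintro rfl
        simp at this
      rw [place_meet _ hv hl]
      have hC' : C = C₁ ∨ C = C₂ := by simpa [hl] using hC
      rcases hC' with rfl | rfl
      · exact crossDet_lineMeet_left _ _ _ _
      · exact crossDet_lineMeet_right ((HasValueAt.lineDet (ha _) (ha _) (ha _) (ha _)).ne_zero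
          (hρ.lineDet_ne_zero hC₁ hC₂ hne))
    · simp [hl] at hcard
  refine ⟨fun C hC => ?_, ?_, fun k => hcross (hρ.boundary k), fun t ht => hcross (hρ.living t ht),
    hinj, fun C hC C' hC' hne hi => ?_⟩
  · by_cases hrel : ∃ v, C ∈ T.relevant ord v
    · obtain ⟨v, hv⟩ := hrel
      have hon : ∀ x ∈ C, crossDet (T.parameterization ord (T.nthVertex ord C 0))
          (T.parameterization ord (T.nthVertex ord C 1)) (T.parameterization ord x) = 0 := by
        intro x hx
        rcases eq_nthVertex_or_mem_relevant (ord := ord) hC hx with h | h | h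
        · rw [h]
          simp [crossDet]
        · rw [h]
          simp only [crossDet]
          ring
        · exact hline x C h
      have hne : T.parameterization ord (T.nthVertex ord C 0) ≠
          T.parameterization ord (T.nthVertex ord C 1) := fun h => by
        have := (nthVertex_of_mem_relevant hv).2.2.1
        rw [hinj h] at this
        exact lt_irrefl _ this
      exact fun x hx y hy z hz => crossDet_eq_zero_of_line hne (hon x hx) (hon y hy) (hon z hz)
    -- Here all vertices of `C` are among its first two, so each determinant has a repeated point.
    · intro x hx y hy z hz
      have h2 : ∀ x ∈ C, x = T.nthVertex ord C 0 ∨ x = T.nthVertex ord C 1 := fun x hx => by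
        rcases eq_nthVertex_or_mem_relevant (ord := ord) hC hx with h | h | h
        · exact Or.inl h
        · exact Or.inr h
        · exact absurd ⟨x, h⟩ hrel
      rcases h2 x hx with h | h <;> rcases h2 y hy with h' | h' <;> rcases h2 z hz with h'' | h'' <;>
        rw [h, h', h''] <;> simp only [crossDet] <;> ring
  · rw [parameterization_eq_place hord (T.corner 2), place_corner_two]
    abel
  · obtain ⟨x, hx, y, hy, z, hz, h⟩ := hρ.lines C hC C' hC' hne hi
    exact ⟨x, hx, y, hy, z, hz, hcross h⟩

end ConstrainedTriangulation

/-- Fields of rational functions over `ℚ` in finitely many variables embed into `ℂ`. -/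
theorem exists_ringHom_fractionRing_complex (σ : Type*) [Finite σ] :
    Nonempty (FractionRing (MvPolynomial σ ℚ) →+* ℂ) := by
  obtain ⟨s, hs⟩ := exists_isTranscendenceBasis ℚ ℂ
  -- A finite transcendence basis would make `ℂ` countable.
  have hinf : Infinite s := by
    by_contra hfin
    rw [not_infinite_iff_finite] at hfin
    have h := IsAlgClosed.cardinal_le_max_transcendence_basis _ hs
    rw [Cardinal.mk_complex] at h
    have h2 : Cardinal.mk s ≤ Cardinal.aleph0 := Cardinal.mk_le_aleph0
    have h3 : Cardinal.mk ℚ ≤ Cardinal.aleph0 := Cardinal.mk_le_aleph0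
    simp only [Cardinal.lift_id] at h
    exact absurd (h.trans (max_le (max_le h3 h2) le_rfl)) (not_le.2 Cardinal.aleph0_lt_continuum)
  obtain ⟨n, ⟨e⟩⟩ := Finite.exists_equiv_fin σ
  let j : σ → s := fun i => Infinite.natEmbedding s (e i)
  have hj : Function.Injective j := fun x y h =>
    e.injective (Fin.ext ((Infinite.natEmbedding s).injective h))
  exact ⟨IsFractionRing.lift (g := (MvPolynomial.aeval
    ((Subtype.val : s → ℂ) ∘ j) : MvPolynomial σ ℚ →ₐ[ℚ] ℂ).toRingHom) (hs.1.comp j hj)⟩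

/-! ### Area polynomials and Monsky polynomials -/

theorem MvPolynomial.totalDegree_le_of_dvd_of_ne_zero {σ R : Type*} [CommRing R] [IsDomain R]
    {f g : MvPolynomial σ R} (h : f ∣ g) (hg : g ≠ 0) : f.totalDegree ≤ g.totalDegree := by
  obtain ⟨q, rfl⟩ := h
  rw [totalDegree_mul_of_isDomain (left_ne_zero_of_mul hg) (right_ne_zero_of_mul hg)]
  exact Nat.le_add_right _ _

theorem MvPolynomial.aeval_map_intCast {σ R S : Type*} [CommRing R] [CommRing S] [Algebra R S]
    [Algebra ℤ S] (x : σ → S) (g : MvPolynomial σ ℤ) :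
    aeval x (map (Int.castRingHom R) g) = aeval x g := by
  rw [aeval_def, eval₂_map, aeval_def]
  congr 1
  exact Subsingleton.elim _ _

theorem MvPolynomial.two_dvd_iff_map_eq_zero {σ : Type*} (f : MvPolynomial σ ℤ) :
    2 ∣ f ↔ map (Int.castRingHom (ZMod 2)) f = 0 := by
  rw [← C_dvd_iff_zmod 2 f]
  simp

namespace ConstrainedTriangulation

variable {V F : Type*} [Fintype V] [DecidableEq V] [Fintype F] {T : ConstrainedTriangulation V F}
  {ord : V ≃ Fin (Fintype.card V)}

theorem sigma_isHomogeneous (R : Type*) [CommRing R] : (T.sigma R).IsHomogeneous 1 :=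
  IsHomogeneous.sum _ _ _ fun i _ => isHomogeneous_X _ i

theorem map_sigma {R S : Type*} [CommRing R] [CommRing S] (φ : R →+* S) :
    map φ (T.sigma R) = T.sigma S := by
  simp [sigma]

theorem aeval_sigma {R S : Type*} [CommRing R] [CommRing S] [Algebra R S] (x : T.Living → S) :
    aeval x (T.sigma R) = ∑ t, x t := by
  simp [sigma]

theorem IsDetGeneric.sum_areas_ne_zero {K : Type*} [Field K] [CharZero K] {g : V → Fin 2 → K}
    (hg : T.IsDetGeneric g) : ∑ t, T.areas g t ≠ 0 := by
  rw [hg.sum_areas]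
  exact hg.crossDet_corner_ne_zero

/-- A polynomial relation between the areas of the parameterized drawing holds in every generic
drawing. -/
theorem IsDetGeneric.aeval_areas_eq_zero {ρ : V → Fin 2 → ℂ} (hρ : T.IsDetGeneric ρ)
    (hord : T.IsDrawingOrder ord) {f : MvPolynomial T.Living ℤ}
    (hf : aeval (T.areas (T.parameterization ord)) f = 0) : aeval (T.areas ρ) f = 0 := by
  obtain ⟨a, ha⟩ := hρ.exists_hasValueAt hord
  have h2 : HasValueAt a 2 2 := by exact_mod_cast HasValueAt.intCast (a := a) 2
  have h : HasValueAt a (aeval (T.areas (T.parameterization ord)) f) (aeval (T.areas ρ) f) := by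
    refine HasValueAt.aeval (fun t => ?_) f
    rw [areas_apply, areas_apply]
    exact (HasValueAt.one.div h2 two_ne_zero).mul (HasValueAt.crossDet (ha _) (ha _) (ha _))
  rw [hf] at h
  exact h.eq_zero

/-- A polynomial relation between the areas in all generic drawings holds in the parameterized
drawing. -/
theorem aeval_areas_parameterization_eq_zero (hT : T.IsDrawable) (hord : T.IsDrawingOrder ord)
    {f : MvPolynomial T.Living ℤ}
    (hf : ∀ ρ : V → Fin 2 → ℂ, T.IsDetGeneric ρ → aeval (T.areas ρ) f = 0) :
    aeval (T.areas (T.parameterization ord)) f = 0 := by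
  obtain ⟨ρ, hρ⟩ := hT
  have hg := ((T.isGenericDrawing_iff_isDetGeneric ρ).1 hρ).parameterization hord
  -- The embedding turns the parameterization into one generic complex drawing, and injectivity
  -- carries the relation back.
  obtain ⟨φ⟩ := exists_ringHom_fractionRing_complex (T.Param ord)
  have h := hf _ (hg.map φ)
  rw [areas_map] at h
  apply φ.injective
  rw [map_zero, ← h]
  rw [aeval_def, aeval_def, ← RingHom.coe_coe, hom_eval₂]
  congr 1
  exact Subsingleton.elim _ _

theorem mk_areas_mem_areaVariety {ρ : V → Fin 2 → ℂ} (hρ : T.IsDetGeneric ρ)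
    (h : T.areas ρ ≠ 0) : Projectivization.mk ℂ (T.areas ρ) h ∈ T.areaVariety :=
  fun _ _ _ hG => hG _
    ⟨ρ, subset_closure ((T.isGenericDrawing_iff_isDetGeneric ρ).2 hρ), h, rfl⟩

theorem IsDetGeneric.areas_ne_zero {K : Type*} [Field K] [CharZero K] {g : V → Fin 2 → K}
    (hg : T.IsDetGeneric g) : T.areas g ≠ 0 := fun h => hg.sum_areas_ne_zero (by simp [h])

/-! ### Vanishing of integer polynomials on the area variety -/

section areaPolynomial

variable {p : MvPolynomial T.Living ℤ}

theorem IsAreaPolynomial.aeval_areas (hp : T.IsAreaPolynomial p) {ρ : V → Fin 2 → ℂ}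
    (hρ : T.IsDetGeneric ρ) : aeval (T.areas ρ) p = 0 := by
  have h : map (Int.castRingHom ℂ) p ∈ T.areaIdeal := by
    rw [hp.2]
    exact Ideal.mem_span_singleton_self _
  rw [areaIdeal, mem_vanishingIdeal_iff] at h
  rw [← aeval_map_intCast (R := ℂ)]
  exact h _ ⟨hρ.areas_ne_zero, mk_areas_mem_areaVariety hρ _⟩

theorem continuous_areas : Continuous fun ρ : V → Fin 2 → ℂ => T.areas ρ := by
  refine continuous_pi fun t => ?_
  simp only [areas_apply, crossDet]
  fun_prop

/-- The homogeneous integer polynomials that vanish at the areas of all generic drawings are the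
multiples of the area polynomial. -/
theorem IsAreaPolynomial.dvd (hp : T.IsAreaPolynomial p) {f : MvPolynomial T.Living ℤ} {m : ℕ}
    (hf : f.IsHomogeneous m)
    (h : ∀ ρ : V → Fin 2 → ℂ, T.IsDetGeneric ρ → aeval (T.areas ρ) f = 0) : p ∣ f := by
  refine dvd_of_primitive_of_map_dvd_map hp.1 ?_
  rw [← Ideal.mem_span_singleton, ← hp.2, areaIdeal, mem_vanishingIdeal_iff]
  -- The image of the area map is taken over a closure, to which a polynomial identity extends by
  -- continuity.
  have hcl : ∀ ρ ∈ T.drawingSpace, aeval (T.areas ρ) f = 0 := by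
    have hclosed : IsClosed {ρ : V → Fin 2 → ℂ | aeval (T.areas ρ) f = 0} := by
      refine isClosed_eq ?_ continuous_const
      have : Continuous fun x : T.Living → ℂ => aeval x f := by
        simp only [← aeval_map_intCast (R := ℂ) _ f]
        exact MvPolynomial.continuous_eval _
      exact this.comp continuous_areas
    exact closure_minimal
      (fun ρ hρ => h ρ ((T.isGenericDrawing_iff_isDetGeneric ρ).1 hρ)) hclosed
  rintro x ⟨hx, hxV⟩
  have hrep := hxV m _ (hf.map (Int.castRingHom ℂ)) (by
    rintro z ⟨ρ, hρ, h0, rfl⟩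
    -- `rep` is an unspecified multiple of the area vector; homogeneity absorbs the scalar.
    obtain ⟨c, hc⟩ := Projectivization.exists_smul_eq_mk_rep ℂ (T.areas ρ) h0
    rw [← hc, ← coe_aeval_eq_eval, RingHom.coe_coe, aeval_map_intCast, Units.smul_def,
      hf.aeval_smul, hcl ρ hρ, mul_zero])
  obtain ⟨c, hc⟩ := Projectivization.exists_smul_eq_mk_rep ℂ x hx
  rw [← hc, ← coe_aeval_eq_eval, RingHom.coe_coe, aeval_map_intCast, Units.smul_def,
    hf.aeval_smul] at hrep
  rw [aeval_map_intCast]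
  exact (mul_eq_zero.1 hrep).resolve_left (pow_ne_zero _ c.ne_zero)

theorem IsAreaPolynomial.ne_zero (hp : T.IsAreaPolynomial p) : p ≠ 0 := by
  rintro rfl
  exact not_isUnit_zero (hp.1 0 fun s => by simp)

/-- Scaling a drawing by `r` scales its areas by `r ^ 2`, and every complex number is a square. So
`p` vanishes at all nonzero multiples of the area vector; as a polynomial in the scalar it is zero,
and its coefficients are the values of the components. -/
theorem IsAreaPolynomial.aeval_homogeneousComponent (hp : T.IsAreaPolynomial p)
    {ρ : V → Fin 2 → ℂ} (hρ : T.IsDetGeneric ρ) (k : ℕ) :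
    aeval (T.areas ρ) (homogeneousComponent k p) = 0 := by
  let Q : Polynomial ℂ := ∑ i ∈ Finset.range (p.totalDegree + 1),
    Polynomial.monomial i (aeval (T.areas ρ) (homogeneousComponent i p))
  have hQ : Q = 0 := by
    apply Polynomial.eq_zero_of_infinite_isRoot
    refine Set.Infinite.mono (s := {0}ᶜ) (fun c hc => ?_) (Set.finite_singleton 0).infinite_compl
    obtain ⟨r, hr⟩ := IsAlgClosed.exists_pow_nat_eq c zero_lt_two
    have hr0 : r ≠ 0 := by
      rintro rfl
      exact hc (by simpa using hr.symm)
    have h := hp.aeval_areas (hρ.smul hr0)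
    rw [areas_smul, hr, ← sum_homogeneousComponent p, map_sum] at h
    simp only [Set.mem_ofPred_eq, Polynomial.IsRoot, Q, Polynomial.eval_finsetSum,
      Polynomial.eval_monomial]
    rw [← h]
    refine Finset.sum_congr rfl fun i _ => ?_
    rw [(homogeneousComponent_isHomogeneous i p).aeval_smul, mul_comm]
  by_cases hk : k ∈ Finset.range (p.totalDegree + 1)
  · have := congrArg (Polynomial.coeff · k) hQ
    simpa [Q, Polynomial.finsetSum_coeff, Polynomial.coeff_monomial,
      Finset.mem_range.1 hk] using this
  · rw [homogeneousComponent_eq_zero k p (by simpa using hk), map_zero]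

/-- Homogeneity is not part of `IsAreaPolynomial`. Each nonzero component vanishes at the areas, so
it is a multiple of `p` and has degree at least that of `p`; only the top component survives. -/
theorem IsAreaPolynomial.isHomogeneous (hp : T.IsAreaPolynomial p) :
    p.IsHomogeneous p.totalDegree := by
  have h : ∀ k, homogeneousComponent k p ≠ 0 → k = p.totalDegree := by
    intro k hk
    refine le_antisymm (not_lt.1 fun hlt => hk (homogeneousComponent_eq_zero k p hlt)) ?_
    have hdvd := hp.dvd (homogeneousComponent_isHomogeneous k p)
      fun ρ hρ => hp.aeval_homogeneousComponent hρ k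
    rw [← (homogeneousComponent_isHomogeneous k p).totalDegree hk]
    exact totalDegree_le_of_dvd_of_ne_zero hdvd hk
  have hsum : p = homogeneousComponent p.totalDegree p := by
    conv_lhs => rw [← sum_homogeneousComponent p]
    exact Finset.sum_eq_single _ (fun k _ hk => by_contra fun h0 => hk (h k h0))
      fun hn => absurd (Finset.mem_range.2 (Nat.lt_succ_self _)) hn
  have hcomp := homogeneousComponent_isHomogeneous p.totalDegree p
  rwa [← hsum] at hcomp

end areaPolynomial

/-! ### Classification of the Monsky polynomials -/

variable {p : MvPolynomial T.Living ℤ}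

theorem IsAreaPolynomial.aeval_areas_parameterization (hT : T.IsDrawable)
    (hord : T.IsDrawingOrder ord) (hp : T.IsAreaPolynomial p) :
    aeval (T.areas (T.parameterization ord)) p = 0 :=
  aeval_areas_parameterization_eq_zero hT hord fun _ hρ => hp.aeval_areas hρ

/-- The homogeneous relations between the areas of the parameterized drawing are the multiples of
the area polynomial. -/
theorem IsAreaPolynomial.dvd_of_aeval_eq_zero (hord : T.IsDrawingOrder ord)
    (hp : T.IsAreaPolynomial p) {f : MvPolynomial T.Living ℤ} {m : ℕ} (hf : f.IsHomogeneous m)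
    (h : aeval (T.areas (T.parameterization ord)) f = 0) : p ∣ f :=
  hp.dvd hf fun _ hρ => hρ.aeval_areas_eq_zero hord h

theorem IsDrawable.isDetGeneric_parameterization (hT : T.IsDrawable)
    (hord : T.IsDrawingOrder ord) : T.IsDetGeneric (T.parameterization ord) := by
  obtain ⟨ρ, hρ⟩ := hT
  exact ((T.isGenericDrawing_iff_isDetGeneric ρ).1 hρ).parameterization hord

theorem IsDrawable.nonempty_living (hT : T.IsDrawable) : Nonempty T.Living := by
  obtain ⟨ρ, hρ⟩ := hT
  by_contra h
  rw [not_nonempty_iff] at h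
  exact ((T.isGenericDrawing_iff_isDetGeneric ρ).1 hρ).sum_areas_ne_zero (by simp)

theorem isHomogeneous_two_mul_sub {g : MvPolynomial T.Living ℤ} {e : ℕ} (hg : g.IsHomogeneous e) :
    (2 * g - T.sigma ℤ ^ e).IsHomogeneous e := by
  have h := (T.sigma_isHomogeneous ℤ).pow e
  rw [one_mul] at h
  have h2 := hg.C_mul 2
  rw [show (C 2 : MvPolynomial T.Living ℤ) = 2 from rfl] at h2
  exact h2.sub h

/-- Modulo `2`, the area polynomial is a power of the sum of the variables. -/
theorem IsAreaPolynomial.map_zmod_two (hT : T.IsDrawable) (hord : T.IsDrawingOrder ord)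
    (hp : T.IsAreaPolynomial p) :
    map (Int.castRingHom (ZMod 2)) p = T.sigma (ZMod 2) ^ p.totalDegree := by
  have := hT.nonempty_living
  obtain ⟨e, f, hf, h⟩ := (hT.isDetGeneric_parameterization hord).exists_two_mul_aeval_eq
  -- `p` divides `2 * f - σ ^ e`, which reduces modulo 2 to `-σ ^ e`.
  have hd := hp.dvd_of_aeval_eq_zero hord (isHomogeneous_two_mul_sub hf)
    (by simp [aeval_sigma, h])
  refine eq_sum_X_pow_of_dvd (e := e) (hp.isHomogeneous.map _) ?_
  have hd' := map_dvd (map (Int.castRingHom (ZMod 2))) hd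
  rw [map_sub, map_mul, (two_dvd_iff_map_eq_zero 2).1 dvd_rfl, zero_mul, zero_sub, map_pow,
    map_sigma, dvd_neg] at hd'
  exact hd'

/-- The degree of a Monsky polynomial is the exponent of its identity. -/
theorem eq_of_two_mul_aeval_eq (hT : T.IsDrawable) (hord : T.IsDrawingOrder ord)
    {g : MvPolynomial T.Living ℤ} {m e : ℕ} (hg : g.IsHomogeneous m)
    (h : 2 * aeval (T.areas (T.parameterization ord)) g =
      (∑ t, T.areas (T.parameterization ord) t) ^ e) : m = e := by
  obtain ⟨ρ, hρ⟩ := hT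
  rw [isGenericDrawing_iff_isDetGeneric] at hρ
  have h0 : aeval (T.areas (T.parameterization ord)) (2 * g - T.sigma ℤ ^ e) = 0 := by
    simp [aeval_sigma, h]
  have h1 := hρ.aeval_areas_eq_zero hord h0
  -- Doubling the drawing multiplies areas by 4; comparing the two identities gives `4 ^ m = 4 ^ e`.
  have h2 := (hρ.smul (two_ne_zero (α := ℂ))).aeval_areas_eq_zero hord h0
  have hS := hρ.sum_areas_ne_zero
  simp only [map_sub, map_mul, map_ofNat, map_pow, aeval_sigma, areas_smul, hg.aeval_smul,
    Pi.smul_apply, smul_eq_mul, ← Finset.mul_sum, mul_pow] at h1 h2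
  have h3 : (((2 : ℂ) ^ 2) ^ m - (2 ^ 2) ^ e) * (∑ t, T.areas ρ t) ^ e = 0 := by
    linear_combination h2 - ((2 : ℂ) ^ 2) ^ m * h1
  have h4 := sub_eq_zero.1 ((mul_eq_zero.1 h3).resolve_right (pow_ne_zero _ hS))
  have h5 : (4 : ℕ) ^ m = 4 ^ e := by
    rw [show ((2 : ℂ) ^ 2) = ((4 : ℕ) : ℂ) by norm_num] at h4
    exact_mod_cast h4
  exact Nat.pow_right_injective (by norm_num) h5

/-- The relation `2 * g - σ ^ m` equals `p * q` and reduces to `σ ^ m ≠ 0` modulo 2. Being nonzero,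
it has degree at least that of `p`; cancelling `p ≡ σ ^ d` modulo 2 gives the congruence for `q`. -/
theorem IsMonskyPolynomial.exists_eq (hT : T.IsDrawable) (hord : T.IsDrawingOrder ord)
    (hp : T.IsAreaPolynomial p) {f₀ : MvPolynomial T.Living ℚ} (hf : T.IsMonskyPolynomial ord f₀) :
    ∃ (e : ℕ) (q : MvPolynomial T.Living ℤ), f₀.IsHomogeneous e ∧ f₀ ≠ 0 ∧
      (p * q).IsHomogeneous e ∧ p.totalDegree ≤ e ∧ 2 ∣ q - T.sigma ℤ ^ (e - p.totalDegree) ∧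
      f₀ = C (1 / 2) * (T.sigma ℚ ^ e + map (Int.castRingHom ℚ) (p * q)) := by
  obtain ⟨⟨g, rfl⟩, ⟨m, hm⟩, e, he⟩ := hf
  have hg : g.IsHomogeneous m := IsHomogeneous.of_map (f := Int.castRingHom ℚ) Int.cast_injective hm
  rw [aeval_map_intCast] at he
  obtain rfl := eq_of_two_mul_aeval_eq hT hord hg he
  have hS := (hT.isDetGeneric_parameterization hord).sum_areas_ne_zero
  have hhom := isHomogeneous_two_mul_sub hg
  obtain ⟨q, hq⟩ := hp.dvd_of_aeval_eq_zero hord hhom (by simp [aeval_sigma, he])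
  have := hT.nonempty_living
  have hσ : T.sigma (ZMod 2) ≠ 0 := by
    classical
    intro h
    obtain ⟨t⟩ := this
    have := congrArg (aeval (Pi.single t (1 : ZMod 2))) h
    simp [aeval_sigma] at this
  have hmod : map (Int.castRingHom (ZMod 2)) (2 * g - T.sigma ℤ ^ m) = T.sigma (ZMod 2) ^ m := by
    rw [map_sub, map_mul, (two_dvd_iff_map_eq_zero 2).1 dvd_rfl, zero_mul, zero_sub, map_pow,
      map_sigma]
    exact CharTwo.neg_eq _
  have hne : 2 * g - T.sigma ℤ ^ m ≠ 0 := by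
    intro h
    rw [h, map_zero] at hmod
    exact pow_ne_zero _ hσ hmod.symm
  have hle : p.totalDegree ≤ m := by
    rw [← hhom.totalDegree hne]
    exact totalDegree_le_of_dvd_of_ne_zero ⟨q, hq⟩ hne
  refine ⟨m, q, hm, ?_, hq ▸ hhom, hle, ?_, ?_⟩
  · intro h
    rw [← aeval_map_intCast (R := ℚ), h, map_zero, mul_zero] at he
    exact pow_ne_zero _ hS he.symm
  · rw [two_dvd_iff_map_eq_zero, map_sub, sub_eq_zero, map_pow, map_sigma]
    refine mul_left_cancel₀ (pow_ne_zero p.totalDegree hσ) ?_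
    rw [← pow_add, Nat.add_sub_cancel' hle, ← hmod, hq, map_mul, hp.map_zmod_two hT hord]
  · rw [← hq, map_sub, map_mul, map_pow, map_sigma, map_ofNat, add_sub_cancel, ← mul_assoc,
      show (2 : MvPolynomial T.Living ℚ) = C 2 from rfl, ← C_mul]
    norm_num

/-- Modulo 2, `p * q ≡ σ ^ d * σ ^ (e - d) = σ ^ e`, so the half is integral. At the areas `p`
vanishes and only `σ ^ e` is left. -/
theorem IsAreaPolynomial.isMonskyPolynomial (hT : T.IsDrawable) (hord : T.IsDrawingOrder ord)
    (hp : T.IsAreaPolynomial p) {e : ℕ} {q : MvPolynomial T.Living ℤ} (hle : p.totalDegree ≤ e)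
    (hq : 2 ∣ q - T.sigma ℤ ^ (e - p.totalDegree))
    (hhom : ∃ m, (C (1 / 2) * (T.sigma ℚ ^ e + map (Int.castRingHom ℚ) (p * q)) :
      MvPolynomial T.Living ℚ).IsHomogeneous m) :
    T.IsMonskyPolynomial ord
      (C (1 / 2) * (T.sigma ℚ ^ e + map (Int.castRingHom ℚ) (p * q))) := by
  have hdvd : 2 ∣ T.sigma ℤ ^ e + p * q := by
    rw [two_dvd_iff_map_eq_zero, map_sub, sub_eq_zero, map_pow, map_sigma] at hq
    rw [two_dvd_iff_map_eq_zero, map_add, map_mul, hq, hp.map_zmod_two hT hord, ← pow_add,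
      Nat.add_sub_cancel' hle, map_pow, map_sigma]
    exact CharTwo.add_self_eq_zero _
  obtain ⟨g, hg⟩ := hdvd
  have hgf : map (Int.castRingHom ℚ) g =
      C (1 / 2) * (T.sigma ℚ ^ e + map (Int.castRingHom ℚ) (p * q)) := by
    have := congrArg (map (Int.castRingHom ℚ)) hg
    rw [map_add, map_pow, map_sigma] at this
    rw [this, map_mul, map_ofNat, ← mul_assoc,
      show (2 : MvPolynomial T.Living ℚ) = C 2 from rfl, ← C_mul]
    norm_num
  refine ⟨⟨g, hgf⟩, hhom, e, ?_⟩
  rw [← hgf, aeval_map_intCast]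
  have := congrArg (aeval (T.areas (T.parameterization ord))) hg
  rw [map_add, map_mul, map_mul, hp.aeval_areas_parameterization hT hord, zero_mul, add_zero,
    map_pow, aeval_sigma, map_ofNat] at this
  exact this.symm

/-- Integer multiples of `p` added to the canonical polynomial correspond to odd constants as the
factor `q`. -/
theorem canonicalMonsky_add (p : MvPolynomial T.Living ℤ) (m : ℤ) :
    T.canonicalMonsky p + C (m : ℚ) * map (Int.castRingHom ℚ) p =
      C (1 / 2) * (T.sigma ℚ ^ p.totalDegree +
        map (Int.castRingHom ℚ) (p * C (2 * m + 1))) := by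
  have h : (C (m : ℚ) : MvPolynomial T.Living ℚ) = C (1 / 2) * (C 2 * C (m : ℚ)) := by
    rw [← C_mul, ← C_mul]
    congr 1
    ring
  rw [canonicalMonsky, h, map_mul, map_C]
  simp only [map_add, map_mul, eq_intCast, Int.cast_ofNat, Int.cast_one, C_1]
  ring

theorem canonicalMonsky_neg_add (p : MvPolynomial T.Living ℤ) (m : ℤ) :
    T.canonicalMonsky (-p) + C ((m + 1 : ℤ) : ℚ) * map (Int.castRingHom ℚ) p =
      T.canonicalMonsky p + C (m : ℚ) * map (Int.castRingHom ℚ) p := by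
  have h : (C (1 / 2) + C (1 / 2) : MvPolynomial T.Living ℚ) = 1 := by
    rw [← C_add]
    norm_num
  rw [canonicalMonsky, canonicalMonsky, totalDegree_neg, map_neg, Int.cast_add, Int.cast_one, C_add,
    C_1]
  linear_combination -map (Int.castRingHom ℚ) p * h

/-- A Monsky polynomial has degree `e ≥ d`, and the canonical one attains `d`. For `e = d`,
additivity of degrees in `p * q` makes `q` a constant, and `q ≡ 1` modulo 2 makes it odd. -/
theorem IsAreaPolynomial.setOf_isMinimalMonskyPolynomial (hT : T.IsDrawable)
    (hord : T.IsDrawingOrder ord) (hp : T.IsAreaPolynomial p) :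
    {f₀ | T.IsMinimalMonskyPolynomial ord f₀} =
      Set.range (fun m : ℤ => T.canonicalMonsky p +
        C (m : ℚ) * map (Int.castRingHom ℚ) p) := by
  have hhom : ∀ m : ℤ, (T.canonicalMonsky p +
      C (m : ℚ) * map (Int.castRingHom ℚ) p).IsHomogeneous p.totalDegree := by
    intro m
    have h1 := (T.sigma_isHomogeneous ℚ).pow p.totalDegree
    rw [one_mul] at h1
    have h2 := hp.isHomogeneous.map (Int.castRingHom ℚ)
    exact ((h1.add h2).C_mul _).add (h2.C_mul _)
  have hmonsky : ∀ m : ℤ, T.IsMonskyPolynomial ord (T.canonicalMonsky p +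
      C (m : ℚ) * map (Int.castRingHom ℚ) p) := by
    intro m
    have h := hhom m
    rw [canonicalMonsky_add] at h ⊢
    refine hp.isMonskyPolynomial hT hord le_rfl ⟨C m, ?_⟩ ⟨_, h⟩
    simp
  ext f₀
  constructor
  · rintro ⟨hf, hmin⟩
    obtain ⟨e, q, hfe, hf0, hpq, hle, hq, hf₀⟩ := hf.exists_eq hT hord hp
    have hde : e = p.totalDegree := by
      refine le_antisymm ?_ hle
      rw [← hfe.totalDegree hf0]
      exact (hmin _ (hmonsky 0)).trans (hhom 0).totalDegree_le
    subst hde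
    rw [Nat.sub_self, pow_zero] at hq
    have hq0 : q ≠ 0 := by
      rintro rfl
      rw [two_dvd_iff_map_eq_zero] at hq
      simp at hq
    have hqd : q.totalDegree = 0 := by
      have := hpq.totalDegree (mul_ne_zero hp.ne_zero hq0)
      rw [totalDegree_mul_of_isDomain hp.ne_zero hq0] at this
      omega
    rw [totalDegree_eq_zero_iff_eq_C] at hqd
    rw [hqd, show (2 : MvPolynomial T.Living ℤ) = C 2 from rfl, ← C_1, ← C_sub,
      C_dvd_iff_dvd_coeff] at hq
    obtain ⟨m, hm⟩ := hq 0
    rw [coeff_zero_C] at hm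
    refine ⟨m, ?_⟩
    rw [hf₀, hqd, sub_eq_iff_eq_add.1 hm]
    exact canonicalMonsky_add p m
  · rintro ⟨m, rfl⟩
    refine ⟨hmonsky m, fun g hg => ?_⟩
    obtain ⟨e, q, hge, hg0, -, hle, -⟩ := hg.exists_eq hT hord hp
    rw [hge.totalDegree hg0]
    exact (hhom m).totalDegree_le.trans hle

end ConstrainedTriangulation

end

theorem mainTheorem6 {V F : Type*} [Fintype V] [DecidableEq V] [Fintype F]
    (T : ConstrainedTriangulation V F) (hT : T.IsHyper)
    (p : MvPolynomial T.Living ℤ) (hp : T.IsAreaPolynomial p)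
    (ord : V ≃ Fin (Fintype.card V)) (hord : T.IsDrawingOrder ord) :
    (∀ f₀ : MvPolynomial T.Living ℚ, T.IsMonskyPolynomial ord f₀ ↔
      (∃ m : ℕ, f₀.IsHomogeneous m) ∧
      ∃ (e : ℕ) (q : MvPolynomial T.Living ℤ), p.totalDegree ≤ e ∧
        2 ∣ q - T.sigma ℤ ^ (e - p.totalDegree) ∧
        f₀ = MvPolynomial.C (1 / 2) *
          (T.sigma ℚ ^ e + MvPolynomial.map (Int.castRingHom ℚ) (p * q))) ∧
    {f₀ | T.IsMinimalMonskyPolynomial ord f₀} =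
      Set.range (fun m : ℤ => T.canonicalMonsky p +
        MvPolynomial.C (m : ℚ) * MvPolynomial.map (Int.castRingHom ℚ) p) ∧
    {f₀ | T.IsMinimalMonskyPolynomial ord f₀} =
      Set.range (fun m : ℤ => T.canonicalMonsky (-p) +
        MvPolynomial.C (m : ℚ) * MvPolynomial.map (Int.castRingHom ℚ) p) := by
  refine ⟨fun f₀ => ⟨fun hf => ?_, ?_⟩, hp.setOf_isMinimalMonskyPolynomial hT.1 hord, ?_⟩
  · obtain ⟨e, q, -, -, -, hle, hq, hf₀⟩ := hf.exists_eq hT.1 hord hp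
    exact ⟨hf.2.1, e, q, hle, hq, hf₀⟩
  · rintro ⟨hhom, e, q, hle, hq, rfl⟩
    exact hp.isMonskyPolynomial hT.1 hord hle hq hhom
  · rw [hp.setOf_isMinimalMonskyPolynomial hT.1 hord]
    ext f
    constructor
    · rintro ⟨m, rfl⟩
      exact ⟨m + 1, T.canonicalMonsky_neg_add p m⟩
    · rintro ⟨m, rfl⟩
      refine ⟨m - 1, ?_⟩
      have h := ConstrainedTriangulation.canonicalMonsky_neg_add p (m - 1)
      rw [sub_add_cancel] at h
      exact h.symm
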